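/- **Setting.** Let $n\ge 2$, let $M$ be a compact connected orientable boundaryless $C^\infty$ manifold (Hausdorff, second countable) of dimension $n$ with a $C^\infty$ volume form $\omega$, and let $(V_i,\phi_i)_{i\le m}$ be a finite smooth atlas of $M$ which is - *conservative*: in each chart $\omega$ pushes forward to the canonical volume form $dx_1\wedge\dots\wedge dx_n$ of $\mathbb R^n$, and there is $\lambda>0$ with $\phi_i(V_i)=\lambda\mathbb B^n$ for all $i$ (where $\mathbb B^n$ is the open unit ball of $\mathbb R^n$); - *regular*: there is a second conservative atlas $(W_i,\Phi_i)_{i\le m}$ of $M$ with $\overline{V_i}\subset W_i$ and $\Phi_i|_{V_i}=\phi_i$ for all $i$. For a vector field $X$ on $M$ let $X_i=(\phi_i)_*X:\phi_i(V_i)\to\mathbb R^n$ be its expression in the $i$-th chart. For $s\in\{1,2,\dots\}\cup\{\infty\}$ and $0\le\beta\le1$, let $\mathfrak X^{s,\beta}_\mu(M)$ be the set of vector fields $X$ on $M$ of vanishing divergence with respect to $\omega$ such that every $X_i$ is of class $C^s$ and, if $s<\infty$ and $\beta>0$, all partial derivatives of $X_i$ of order $s$ are $\beta$-Hölder continuous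 on $\phi_i(V_i)$ (so $C^{s,0}=C^s$ and $C^{\infty,\beta}=C^\infty$). Let $$\|X\|_{C^1}=\max_{i\le m}\ \max_{k\in\{0,1\}}\ \sup_{\phi_i(V_i)}\|D^kX_i\|,$$ with the Euclidean norm on $\mathbb R^n$ and the corresponding operator norm $\|\cdot\|$. **Theorem 6** ($C^{s,\beta}$ conservative local linearization, "Franks lemma type"). There is a constant $\chi>0$, depending only on the atlas, with the following property. Let $\epsilon>0$, $s\in\{1,2,\dots\}\cup\{\infty\}$, $0\le\beta\le1$, $v\in\mathfrak X^{s,\beta}_\mu(M)$, let $\Sigma\subset M$ be a finite set and $U\subset M$ a neighbourhood of $\Sigma$. For each $x\in\Sigma$ let $(V_x,\phi_x)$ be a chart of the atlas with $x\in V_x$, let $v_x=(\phi_x)_*v$, and let $A_x:\mathbb R^n\to\mathbb R^n$ be a traceless linear map with $$\|A_x-Dv_x(\phi_x(x))\|<\chi\,\epsilon .$$ Then there is $Z\in\mathfrak X^{s,\beta}_\mu(M)$ such that 1. for each $x\in\Sigma$, $\ ((\phi_x)_*Z)(y)=v_x(\phi_x(x))+A_x\,(y-\phi_x(x))\ $ for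 all $y$ in a neighbourhood of $\phi_x(x)$ in $\mathbb R^n$; 2. $Z=v$ on $M\setminus U$; 3. $\|Z-v\|_{C^1}<\epsilon$. -/

import Mathlib

open Set Filter Topology Manifold
open scoped ContDiff NNReal ENNReal

noncomputable section

namespace ConservativeFields

/-- Euclidean space `ℝⁿ` with the Euclidean norm. -/
abbrev E (n : ℕ) : Type := EuclideanSpace ℝ (Fin n)

section Charts

variable {n : ℕ} {M : Type*} [TopologicalSpace M] [ChartedSpace (E n) M]

/-- The expression of a vector field `X` on `M` in a chart `e`, that is, the push-forward `e_* X`;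
only its values on `e.target` are meaningful. -/
def chartExpr (e : OpenPartialHomeomorph M (E n)) (X : ∀ p : M, TangentSpace (𝓡 n) p)
    (y : E n) : E n :=
  mfderiv (𝓡 n) (𝓡 n) e (e.symm y) (X (e.symm y))

/-- The expression in a chart `e` of a field of alternating `n`-forms on `M`, that is, the
push-forward of the form by `e` (its pull-back by `e.symm`). -/
def formInChart (vol : ∀ p : M, (TangentSpace (𝓡 n) p) [⋀^Fin n]→ₗ[ℝ] ℝ)
    (e : OpenPartialHomeomorph M (E n)) (y : E n) : (E n) [⋀^Fin n]→ₗ[ℝ] ℝ :=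
  (vol (e.symm y)).compLinearMap (mfderiv (𝓡 n) (𝓡 n) e.symm y).toLinearMap

/-- The canonical volume form `dx₁ ∧ ⋯ ∧ dxₙ` on `ℝⁿ`. -/
def canonicalForm (n : ℕ) : (E n) [⋀^Fin n]→ₗ[ℝ] ℝ :=
  (EuclideanSpace.basisFun (Fin n) ℝ).toBasis.det

/-- The coefficient `ρ` of an `n`-form `ρ dx₁ ∧ ⋯ ∧ dxₙ` in a chart. -/
def formDensity (vol : ∀ p : M, (TangentSpace (𝓡 n) p) [⋀^Fin n]→ₗ[ℝ] ℝ)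
    (e : OpenPartialHomeomorph M (E n)) (y : E n) : ℝ :=
  formInChart vol e y (EuclideanSpace.basisFun (Fin n) ℝ)

end Charts

/-- A `C^∞` volume form: a nowhere vanishing `n`-form whose coefficient is smooth in every
smooth chart. -/
structure VolumeForm (n : ℕ) (M : Type*) [TopologicalSpace M] [ChartedSpace (E n) M] where
  /-- the value of the form at a point -/
  form : ∀ p : M, (TangentSpace (𝓡 n) p) [⋀^Fin n]→ₗ[ℝ] ℝ
  ne_zero : ∀ p, form p ≠ 0
  smooth : ∀ e ∈ IsManifold.maximalAtlas (𝓡 n) ∞ M,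
    ContDiffOn ℝ ∞ (formDensity form e) e.target

/-- A finite family `(Vᵢ, φᵢ)`, `i < m`, of smooth charts covering `M`; here `Vᵢ` is the source of
`chart i`. -/
structure FiniteAtlas (n m : ℕ) (M : Type*) [TopologicalSpace M] [ChartedSpace (E n) M] where
  /-- the charts of the atlas -/
  chart : Fin m → OpenPartialHomeomorph M (E n)
  mem_maximalAtlas : ∀ i, chart i ∈ IsManifold.maximalAtlas (𝓡 n) ∞ M
  cover : ⋃ i, (chart i).source = univ

/-- `f` is of class `C^{s,β}` on the open set `Ω`, with `C^{s,0} = C^s` and `C^{∞,β} = C^∞`. All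
partial derivatives of order `s` are `β`-Hölder exactly when the total derivative of order `s` is. -/
def IsHolderClassOn {n : ℕ} (s : ℕ∞) (β : ℝ≥0) (f : E n → E n) (Ω : Set (E n)) : Prop :=
  ContDiffOn ℝ s f Ω ∧
    (0 < β → ∀ k : ℕ, s = k → ∃ C : ℝ≥0, HolderOnWith C β (iteratedFDeriv ℝ k f) Ω)

/-- The divergence with respect to `vol = ρ dx₁ ∧ ⋯ ∧ dxₙ`, computed in the chart `e`:
`ρ⁻¹ ∑ᵢ ∂ᵢ(ρ Xⁱ)`. -/
def divInChart {n : ℕ} {M : Type*} [TopologicalSpace M] [ChartedSpace (E n) M]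
    (vol : VolumeForm n M) (e : OpenPartialHomeomorph M (E n))
    (X : ∀ p : M, TangentSpace (𝓡 n) p) (y : E n) : ℝ :=
  (formDensity vol.form e y)⁻¹ *
    LinearMap.trace ℝ (E n)
      (fderiv ℝ (fun z => formDensity vol.form e z • chartExpr e X z) y).toLinearMap

namespace FiniteAtlas

variable {n m : ℕ} {M : Type*} [TopologicalSpace M] [ChartedSpace (E n) M]

/-- The atlas is conservative for `vol`: in each chart `vol` is the canonical volume form, and all
chart images are one and the same ball `λ 𝔹ⁿ`. -/
def IsConservative (𝒜 : FiniteAtlas n m M) (vol : VolumeForm n M) : Prop :=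
  (∀ i, ∀ y ∈ (𝒜.chart i).target, formInChart vol.form (𝒜.chart i) y = canonicalForm n) ∧
    ∃ l : ℝ, 0 < l ∧ ∀ i, (𝒜.chart i).target = Metric.ball 0 l

/-- The atlas is regular: its charts extend to those of a larger conservative atlas `(Wᵢ, Φᵢ)` with
`closure Vᵢ ⊆ Wᵢ`. -/
def IsRegular (𝒜 : FiniteAtlas n m M) (vol : VolumeForm n M) : Prop :=
  ∃ ℬ : FiniteAtlas n m M, ℬ.IsConservative vol ∧
    ∀ i, closure (𝒜.chart i).source ⊆ (ℬ.chart i).source ∧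
      EqOn (ℬ.chart i) (𝒜.chart i) (𝒜.chart i).source

/-- The divergence-free vector fields of class `C^{s,β}` on `M`. -/
def divFreeFields (𝒜 : FiniteAtlas n m M) (vol : VolumeForm n M) (s : ℕ∞) (β : ℝ≥0) :
    Set (∀ p : M, TangentSpace (𝓡 n) p) :=
  {X | ∀ i, IsHolderClassOn s β (chartExpr (𝒜.chart i) X) (𝒜.chart i).target ∧
    ∀ y ∈ (𝒜.chart i).target, divInChart vol (𝒜.chart i) X y = 0}

/-- The Whitney `C^r` norm of a vector field on `M`: the supremum, over all charts of the atlas, all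
points of the chart image and all orders `k ≤ r`, of the operator norm of the `k`-th derivative of
the chart expression. -/
def whitneyNorm (𝒜 : FiniteAtlas n m M) (r : ℕ) (X : ∀ p : M, TangentSpace (𝓡 n) p) : ℝ≥0∞ :=
  ⨆ (i : Fin m) (k : ℕ) (_ : k ≤ r) (y ∈ (𝒜.chart i).target),
    ‖iteratedFDeriv ℝ k (chartExpr (𝒜.chart i) X) y‖ₑ

end FiniteAtlas

end ConservativeFields

end

open ConservativeFields

/-! In a chart, let `u` be the wanted affine field minus `v`. It is divergence free, vanishes at the
point `p`, and its derivative at `p` is `A - Dv(p)`, which is small. It suffices to cut `u` off near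
`p` without losing zero divergence, regularity or `C¹` smallness, and to add the result to `v`.

The cutoff is made on the level of forms. For a divergence-free `w` on a ball, the `(n-1)`-form `ι_w
vol` is closed. Poincaré's radial homotopy gives a primitive built from `b(y) = ∫₀¹ t^(n-2) w(ty)
dt`, which is `radialMean (n - 2) w`. Multiplying the primitive by a function `g(|z|²)` and
differentiating gives, as a vector field, `g w + 2g'(|z|² b - ⟨z, b⟩ z)`: this is `localize w`. No
derivative of `w` appears in it and `b` is an average of dilates of `w`, so the class `C^{s,β}` is
preserved. Zero divergence is verified directly in `euclDiv_localize`, from Euler's identity for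
`b`.

If `w 0 = 0` and `‖Dw‖ ≤ δ`, the localized field is `O(δ)` in `C¹`. The rescaling `w(z) = u(p +
rz)/r` does not change derivatives, so the same constant serves every radius
(`exists_isLocalizationConstant`). This is why the final constant depends neither on `v` nor on the
set of points or its neighbourhood.

On the manifold, changes of charts have Jacobian one, so a compactly supported divergence-free field
in one chart is divergence free in all of them (`euclDiv_pushField`, `det_fderiv_transition`).
Regularity of the atlas bounds the changes of charts in `C²`, hence the loss in the `C¹` norm, and
turns local Hölder regularity into uniform regularity. The corrections at the different points have
disjoint supports, so their `C¹` bounds do not add up. -/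

noncomputable section

namespace ConservativeFields

/-! ### Calculus of local Hölder classes: sums, products, composition, compactness. -/

section HolderCalculus

section Local

variable {X F G : Type*} [NormedAddCommGroup X] [NormedAddCommGroup F] [NormedAddCommGroup G]
  {β : ℝ≥0}

/-- `f` is `β`-Hölder on some neighbourhood of `x`. -/
def LocallyHolderAt {X F : Type*} [PseudoEMetricSpace X] [PseudoEMetricSpace F]
    (β : ℝ≥0) (f : X → F) (x : X) : Prop :=
  ∃ C : ℝ≥0, ∃ u ∈ 𝓝 x, HolderOnWith C β f u

theorem LocallyHolderAt.congr {f g : X → F} {x : X} (hf : LocallyHolderAt β f x)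
    (h : g =ᶠ[𝓝 x] f) : LocallyHolderAt β g x := by
  obtain ⟨C, u, hu, hC⟩ := hf
  refine ⟨C, _, inter_mem hu h, fun y hy z hz => ?_⟩
  rw [show g y = f y from hy.2, show g z = f z from hz.2]
  exact hC y hy.1 z hz.1

theorem LocallyHolderAt.comp_lipschitz {f : X → F} {g : F → G} {x : X} {K : ℝ≥0} {u : Set X}
    (hg : LocallyHolderAt β g (f x)) (hu : u ∈ 𝓝 x) (hf : LipschitzOnWith K f u) :
    LocallyHolderAt β (fun y => g (f y)) x := by
  obtain ⟨C, v, hv, hC⟩ := hg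
  have hc : ContinuousAt f x := hf.continuousOn.continuousAt hu
  refine ⟨C * K ^ (β : ℝ), _, inter_mem hu (hc hv), fun y hy z hz => ?_⟩
  calc edist (g (f y)) (g (f z)) ≤ C * edist (f y) (f z) ^ (β : ℝ) := hC _ hy.2 _ hz.2
    _ ≤ C * (K * edist y z) ^ (β : ℝ) := by gcongr; exact hf hy.1 hz.1
    _ = _ := by
      rw [ENNReal.mul_rpow_of_nonneg _ _ β.coe_nonneg, ENNReal.coe_mul,
        ENNReal.coe_rpow_of_nonneg _ β.coe_nonneg, mul_assoc]

theorem LocallyHolderAt.add {f g : X → F} {x : X} (hf : LocallyHolderAt β f x)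
    (hg : LocallyHolderAt β g x) : LocallyHolderAt β (fun y => f y + g y) x := by
  obtain ⟨C, u, hu, hC⟩ := hf
  obtain ⟨D, v, hv, hD⟩ := hg
  refine ⟨C + D, _, inter_mem hu hv, fun y hy z hz => ?_⟩
  calc edist (f y + g y) (f z + g z) ≤ edist (f y) (f z) + edist (g y) (g z) :=
        edist_add_add_le _ _ _ _
    _ ≤ C * edist y z ^ (β : ℝ) + D * edist y z ^ (β : ℝ) :=
        add_le_add (hC y hy.1 z hz.1) (hD y hy.2 z hz.2)
    _ = _ := by push_cast; ring

/-- On a set of bounded diameter a Lipschitz map is Hölder for every smaller exponent; the unit ball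
has diameter at most `2`, whence `D := 2`. -/
theorem LocallyHolderAt.of_lipschitz {f : X → F} {x : X} {K : ℝ≥0} {u : Set X} (hβ : β ≤ 1)
    (hu : u ∈ 𝓝 x) (hf : LipschitzOnWith K f u) : LocallyHolderAt β f x := by
  have hK : HolderOnWith K 1 f (u ∩ Metric.ball x 1) :=
    holderOnWith_one.2 (hf.mono inter_subset_left)
  refine ⟨_, _, inter_mem hu (Metric.ball_mem_nhds x one_pos),
    hK.of_le (D := 2) (fun y hy z hz => ?_) hβ⟩
  rw [edist_nndist]
  norm_cast
  rw [← NNReal.coe_le_coe, coe_nndist]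
  have h1 : dist y x < 1 := hy.2
  have h2 : dist z x < 1 := hz.2
  have := dist_triangle_right y z x
  push_cast
  linarith

theorem exists_nnnorm_bound {f : X → F} {x : X} (hf : ContinuousAt f x) :
    ∃ K : ℝ≥0, ∀ᶠ y in 𝓝 x, ‖f y‖₊ ≤ K :=
  ⟨‖f x‖₊ + 1, (hf.nnnorm.eventually_lt continuousAt_const
    (lt_add_of_pos_right _ one_pos)).mono fun _ h => h.le⟩

/-- The estimate is localized at pairs of points in `K ×ˢ K`. Near the diagonal it is the local
Hölder condition; away from it the distance is bounded below and `f` is locally bounded. No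
convexity of `K` is needed. -/
theorem exists_holderOnWith_of_isCompact {f : X → F} {K : Set X} (hK : IsCompact K) (hβ : 0 < β)
    (hf : ∀ x ∈ K, LocallyHolderAt β f x) : ∃ C : ℝ≥0, HolderOnWith C β f K := by
  have hc : ∀ x ∈ K, ContinuousAt f x := fun x hx => by
    obtain ⟨C, u, hu, hC⟩ := hf x hx
    exact (hC.continuousOn hβ).continuousAt hu
  suffices h : ∃ C : ℝ≥0, ∀ p ∈ K ×ˢ K, edist (f p.1) (f p.2) ≤ C * edist p.1 p.2 ^ (β : ℝ) by
    obtain ⟨C, hC⟩ := h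
    exact ⟨C, fun x hx y hy => hC (x, y) ⟨hx, hy⟩⟩
  refine (hK.prod hK).induction_on
    (p := fun t => ∃ C : ℝ≥0, ∀ p ∈ t, edist (f p.1) (f p.2) ≤ C * edist p.1 p.2 ^ (β : ℝ))
    ⟨0, by simp⟩ (fun t u htu ⟨C, hC⟩ => ⟨C, fun p hp => hC p (htu hp)⟩) ?_ ?_
  · rintro t u ⟨C, hC⟩ ⟨D, hD⟩
    refine ⟨max C D, ?_⟩
    rintro p (hp | hp)
    · exact (hC p hp).trans (by gcongr; exact le_max_left _ _)
    · exact (hD p hp).trans (by gcongr; exact le_max_right _ _)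
  · rintro ⟨x, y⟩ ⟨hx, hy⟩
    rcases eq_or_ne x y with rfl | hxy
    · obtain ⟨C, u, hu, hC⟩ := hf x hx
      exact ⟨_, mem_nhdsWithin_of_mem_nhds (prod_mem_nhds hu hu), C,
        fun p hp => hC _ hp.1 _ hp.2⟩
    -- Off the diagonal: near `(x, y)` the numerator stays below its value plus one and the
    -- denominator above half its value.
    · have h1 : ContinuousAt (fun p : X × X => nndist (f p.1) (f p.2)) (x, y) :=
        ((hc x hx).comp (x := (x, y)) continuousAt_fst).nndist
          ((hc y hy).comp (x := (x, y)) continuousAt_snd)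
      have h2 : ContinuousAt (fun p : X × X => nndist p.1 p.2 ^ (β : ℝ)) (x, y) :=
        (NNReal.continuous_rpow_const β.coe_nonneg).continuousAt.comp
          continuous_nndist.continuousAt
      have h3 : (0 : ℝ≥0) < nndist x y ^ (β : ℝ) :=
        NNReal.rpow_pos (pos_iff_ne_zero.2 (by simpa using hxy))
      set d := nndist x y ^ (β : ℝ) with hd
      refine ⟨_, mem_nhdsWithin_of_mem_nhds (inter_mem
        (h1.eventually_lt continuousAt_const (lt_add_of_pos_right _ one_pos))
        (continuousAt_const.eventually_lt h2 (half_lt_self h3))),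
        (nndist (f x) (f y) + 1) / (d / 2), fun p hp => ?_⟩
      have h4 : nndist (f p.1) (f p.2) < nndist (f x) (f y) + 1 := hp.1
      have h5 : d / 2 < nndist p.1 p.2 ^ (β : ℝ) := hp.2
      rw [edist_nndist, edist_nndist, ← ENNReal.coe_rpow_of_nonneg _ β.coe_nonneg]
      norm_cast
      calc _ ≤ _ := h4.le
        _ = (nndist (f x) (f y) + 1) / (d / 2) * (d / 2) := by
          rw [div_mul_cancel₀]; positivity
        _ ≤ _ := by gcongr

/-- Used with the currying isometries that relate `iteratedFDeriv` of successive orders. -/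
theorem locallyHolderAt_congr_edist {f : X → F} {g : X → G} {x : X}
    (h : ∀ y z, edist (f y) (f z) = edist (g y) (g z)) :
    LocallyHolderAt β f x ↔ LocallyHolderAt β g x := by
  simp only [LocallyHolderAt, HolderOnWith, h]

end Local

universe u

variable {X F G H : Type u} [NormedAddCommGroup X] [NormedSpace ℝ X]
  [NormedAddCommGroup F] [NormedSpace ℝ F] [NormedAddCommGroup G] [NormedSpace ℝ G]
  [NormedAddCommGroup H] [NormedSpace ℝ H] {β : ℝ≥0}

theorem edist_clm₂_le (B : F →L[ℝ] G →L[ℝ] H) (a a' : F) (b b' : G) :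
    edist (B a b) (B a' b') ≤ ‖B‖ₑ * (‖a‖ₑ * edist b b' + ‖b'‖ₑ * edist a a') := by
  have h : B a b - B a' b' = B a (b - b') + B (a - a') b' := by
    simp
  have h1 : ∀ (c : F) (d : G), ‖B c d‖ₑ ≤ ‖B‖ₑ * ‖c‖ₑ * ‖d‖ₑ := fun c d => by
    have := B.le_opNorm₂ c d
    simp only [enorm_eq_nnnorm]
    exact_mod_cast this
  rw [edist_eq_enorm_sub, edist_eq_enorm_sub, edist_eq_enorm_sub, h]
  calc _ ≤ ‖B a (b - b')‖ₑ + ‖B (a - a') b'‖ₑ := enorm_add_le _ _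
    _ ≤ _ := add_le_add (h1 _ _) (h1 _ _)
    _ = _ := by ring

theorem LocallyHolderAt.clm₂ {X : Type*} [NormedAddCommGroup X] {f : X → F} {g : X → G} {x : X}
    (B : F →L[ℝ] G →L[ℝ] H)
    (hf : LocallyHolderAt β f x) (hg : LocallyHolderAt β g x) (hfc : ContinuousAt f x)
    (hgc : ContinuousAt g x) : LocallyHolderAt β (fun y => B (f y) (g y)) x := by
  obtain ⟨C, u, hu, hC⟩ := hf
  obtain ⟨D, v, hv, hD⟩ := hg
  obtain ⟨K, hK⟩ := exists_nnnorm_bound hfc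
  obtain ⟨L, hL⟩ := exists_nnnorm_bound hgc
  refine ⟨‖B‖₊ * (K * D + L * C), _, inter_mem (inter_mem hu hv) (inter_mem hK hL),
    fun y hy z hz => ?_⟩
  calc _ ≤ _ := edist_clm₂_le B _ _ _ _
    _ ≤ ‖B‖ₑ * (K * (D * edist y z ^ (β : ℝ)) + L * (C * edist y z ^ (β : ℝ))) := by
      gcongr
      · rw [enorm_eq_nnnorm]; exact_mod_cast hy.2.1
      · exact hD y hy.1.2 z hz.1.2
      · rw [enorm_eq_nnnorm]; exact_mod_cast hz.2.2
      · exact hC y hy.1.1 z hz.1.1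
    _ = _ := by rw [enorm_eq_nnnorm]; push_cast; ring

/-- `f` is of class `C^{k,β}` on some neighbourhood of `x`. -/
def IsHolderAt (k : ℕ) (β : ℝ≥0) (f : X → F) (x : X) : Prop :=
  ContDiffAt ℝ k f x ∧ LocallyHolderAt β (iteratedFDeriv ℝ k f) x

theorem IsHolderAt.congr {k : ℕ} {f g : X → F} {x : X} (hf : IsHolderAt k β f x)
    (h : g =ᶠ[𝓝 x] f) : IsHolderAt k β g x :=
  ⟨hf.1.congr_of_eventuallyEq h, hf.2.congr (h.iteratedFDeriv ℝ k)⟩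

theorem isHolderAt_zero {f : X → F} {x : X} :
    IsHolderAt 0 β f x ↔ ContDiffAt ℝ 0 f x ∧ LocallyHolderAt β f x := by
  refine and_congr (by simp) (locallyHolderAt_congr_edist fun y z => ?_)
  rw [iteratedFDeriv_zero_eq_comp]
  exact (continuousMultilinearCurryFin0 ℝ X F).symm.isometry.edist_eq _ _

/-- This recursion on the order is what the inductions for products, compositions and radial means
run on. -/
theorem isHolderAt_succ {k : ℕ} {f : X → F} {x : X} :
    IsHolderAt (k + 1) β f x ↔ ContDiffAt ℝ (k + 1) f x ∧ IsHolderAt k β (fderiv ℝ f) x := by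
  have key : LocallyHolderAt β (iteratedFDeriv ℝ (k + 1) f) x ↔
      LocallyHolderAt β (iteratedFDeriv ℝ k (fderiv ℝ f)) x := by
    refine locallyHolderAt_congr_edist fun y z => ?_
    rw [iteratedFDeriv_succ_eq_comp_right, iteratedFDeriv_succ_eq_comp_right]
    exact (continuousMultilinearCurryRightEquiv' ℝ k X F).symm.isometry.edist_eq _ _
  refine ⟨fun h => ⟨h.1, h.1.fderiv_right le_rfl, key.1 h.2⟩, fun h => ⟨h.1, key.2 h.2.2⟩⟩

theorem IsHolderAt.of_contDiffAt {k : ℕ} {f : X → F} {x : X} (hβ : β ≤ 1)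
    (hf : ContDiffAt ℝ (k + 1) f x) : IsHolderAt k β f x := by
  refine ⟨hf.of_le (by exact_mod_cast Nat.le_succ k), ?_⟩
  have h : ContDiffAt ℝ 1 (iteratedFDeriv ℝ k f) x :=
    hf.iteratedFDeriv_right (by rw [add_comm])
  obtain ⟨K, u, hu, hK⟩ := h.exists_lipschitzOnWith
  exact .of_lipschitz hβ hu hK

theorem IsHolderAt.of_succ {k : ℕ} {f : X → F} {x : X} (hβ : β ≤ 1)
    (hf : IsHolderAt (k + 1) β f x) : IsHolderAt k β f x :=
  .of_contDiffAt hβ hf.1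

theorem IsHolderAt.add {k : ℕ} {f g : X → F} {x : X} (hf : IsHolderAt k β f x)
    (hg : IsHolderAt k β g x) : IsHolderAt k β (fun y => f y + g y) x := by
  refine ⟨hf.1.add hg.1, (hf.2.add hg.2).congr ?_⟩
  filter_upwards [hf.1.eventually (by simp), hg.1.eventually (by simp)] with y h1 h2
  exact iteratedFDeriv_add_apply h1 h2

/-- Induction through the Leibniz rule. The derivative takes values in spaces of linear maps, so the
target spaces vary in the induction and all live in one universe. -/
theorem IsHolderAt.clm₂ (hβ : β ≤ 1) {k : ℕ} {f : X → F} {g : X → G} {x : X}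
    (B : F →L[ℝ] G →L[ℝ] H) (hf : IsHolderAt k β f x) (hg : IsHolderAt k β g x) :
    IsHolderAt k β (fun y => B (f y) (g y)) x := by
  induction k generalizing F G H with
  | zero =>
    have h1 := isHolderAt_zero.1 hf
    have h2 := isHolderAt_zero.1 hg
    exact isHolderAt_zero.2 ⟨B.isBoundedBilinearMap.contDiff.contDiffAt.comp x
      (h1.1.prodMk h2.1), h1.2.clm₂ B h2.2 h1.1.continuousAt h2.1.continuousAt⟩
  | succ k ih =>
    have h1 := isHolderAt_succ.1 hf
    have h2 := isHolderAt_succ.1 hg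
    refine isHolderAt_succ.2 ⟨B.isBoundedBilinearMap.contDiff.contDiffAt.comp x
      (h1.1.prodMk h2.1), ?_⟩
    refine ((ih (B.precompR X) (hf.of_succ hβ) h2.2).add
      (ih (B.precompL X) h1.2 (hg.of_succ hβ))).congr ?_
    filter_upwards [h1.1.eventually (by simp), h2.1.eventually (by simp)] with y h3 h4
    exact B.fderiv_of_bilinear (h3.differentiableAt (by simp)) (h4.differentiableAt (by simp))

/-- By the chain rule `D(g ∘ f) = (Dg ∘ f) · Df`, a bilinear expression in a term covered by
induction and a smooth one. -/
theorem IsHolderAt.comp (hβ : β ≤ 1) {k : ℕ} {f : X → F} {g : F → G} {x : X}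
    (hg : IsHolderAt k β g (f x)) (hf : ContDiffAt ℝ ∞ f x) :
    IsHolderAt k β (fun y => g (f y)) x := by
  induction k generalizing G with
  | zero =>
    have h1 := isHolderAt_zero.1 hg
    obtain ⟨K, u, hu, hK⟩ := (hf.of_le (m := 1) (by exact_mod_cast le_top)).exists_lipschitzOnWith
    exact isHolderAt_zero.2 ⟨h1.1.comp x (hf.of_le (by exact_mod_cast le_top)),
      h1.2.comp_lipschitz hu hK⟩
  | succ k ih =>
    have h1 := isHolderAt_succ.1 hg
    have hf' : ContDiffAt ℝ (k + 1) f x := hf.of_le (by exact_mod_cast le_top)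
    refine isHolderAt_succ.2 ⟨h1.1.comp x hf', ?_⟩
    have hd : ContDiffAt ℝ ∞ (fderiv ℝ f) x := hf.fderiv_right (by simp)
    have h2 : IsHolderAt k β (fderiv ℝ f) x :=
      .of_contDiffAt hβ (hd.of_le (by exact_mod_cast le_top))
    refine ((ih h1.2).clm₂ hβ (ContinuousLinearMap.compL ℝ X F G) h2).congr ?_
    filter_upwards [hf'.eventually (by simp),
      hf.continuousAt.eventually (h1.1.eventually (by simp))] with y h3 h4
    exact fderiv_comp y (h4.differentiableAt (by simp)) (h3.differentiableAt (by simp))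

/-- `f` is of class `C^{s,β}` on some neighbourhood of `x`, with `C^{s,0} = C^s` and
`C^{∞,β} = C^∞`. -/
def IsHolderClassAt (s : ℕ∞) (β : ℝ≥0) (f : X → F) (x : X) : Prop :=
  ContDiffAt ℝ s f x ∧ (0 < β → ∀ k : ℕ, s = k → IsHolderAt k β f x)

variable {s : ℕ∞}

theorem IsHolderClassAt.congr {f g : X → F} {x : X} (hf : IsHolderClassAt s β f x)
    (h : g =ᶠ[𝓝 x] f) : IsHolderClassAt s β g x :=
  ⟨hf.1.congr_of_eventuallyEq h, fun h0 k hk => (hf.2 h0 k hk).congr h⟩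

theorem IsHolderClassAt.of_contDiffAt {f : X → F} {x : X} (hβ : β ≤ 1)
    (hf : ContDiffAt ℝ ∞ f x) : IsHolderClassAt s β f x :=
  ⟨hf.of_le (by exact_mod_cast le_top),
    fun _ _ _ => .of_contDiffAt hβ (hf.of_le (by exact_mod_cast le_top))⟩

theorem IsHolderClassAt.add {f g : X → F} {x : X} (hf : IsHolderClassAt s β f x)
    (hg : IsHolderClassAt s β g x) : IsHolderClassAt s β (fun y => f y + g y) x :=
  ⟨hf.1.add hg.1, fun h0 k hk => (hf.2 h0 k hk).add (hg.2 h0 k hk)⟩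

theorem IsHolderClassAt.clm₂ (hβ : β ≤ 1) {f : X → F} {g : X → G} {x : X}
    (B : F →L[ℝ] G →L[ℝ] H) (hf : IsHolderClassAt s β f x) (hg : IsHolderClassAt s β g x) :
    IsHolderClassAt s β (fun y => B (f y) (g y)) x :=
  ⟨B.isBoundedBilinearMap.contDiff.contDiffAt.comp x (hf.1.prodMk hg.1),
    fun h0 k hk => (hf.2 h0 k hk).clm₂ hβ B (hg.2 h0 k hk)⟩

theorem IsHolderClassAt.clm_apply (hβ : β ≤ 1) {f : X → (F →L[ℝ] G)} {g : X → F} {x : X}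
    (hf : IsHolderClassAt s β f x) (hg : IsHolderClassAt s β g x) :
    IsHolderClassAt s β (fun y => f y (g y)) x :=
  hf.clm₂ hβ (ContinuousLinearMap.id ℝ (F →L[ℝ] G)) hg

theorem IsHolderClassAt.comp (hβ : β ≤ 1) {f : X → F} {g : F → G} {x : X}
    (hg : IsHolderClassAt s β g (f x)) (hf : ContDiffAt ℝ ∞ f x) :
    IsHolderClassAt s β (fun y => g (f y)) x :=
  ⟨hg.1.comp x (hf.of_le (by exact_mod_cast le_top)),
    fun h0 k hk => (hg.2 h0 k hk).comp hβ hf⟩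

theorem isHolderClassOn_of_isCompact {n : ℕ} {f : E n → E n} {K Ω : Set (E n)}
    (hK : IsCompact K) (hΩ : Ω ⊆ K) (hf : ∀ x ∈ K, IsHolderClassAt s β f x) :
    IsHolderClassOn s β f Ω := by
  refine ⟨fun x hx => (hf x (hΩ hx)).1.contDiffWithinAt, fun h0 k hk => ?_⟩
  obtain ⟨C, hC⟩ := exists_holderOnWith_of_isCompact hK h0
    fun x hx => ((hf x hx).2 h0 k hk).2
  exact ⟨C, hC.mono hΩ⟩

theorem IsHolderClassOn.isHolderClassAt {n : ℕ} {f : E n → E n}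
    {Ω : Set (E n)} (hf : IsHolderClassOn s β f Ω) (hΩ : IsOpen Ω) {x : E n} (hx : x ∈ Ω) :
    IsHolderClassAt s β f x := by
  have h := hf.1.contDiffAt (hΩ.mem_nhds hx)
  refine ⟨h, fun h0 k hk => ?_⟩
  obtain ⟨C, hC⟩ := hf.2 h0 k hk
  subst hk
  exact ⟨h, C, Ω, hΩ.mem_nhds hx, hC⟩

theorem IsHolderClassOn.add {n : ℕ} {f g : E n → E n} {Ω : Set (E n)}
    (hf : IsHolderClassOn s β f Ω) (hΩ : IsOpen Ω) (hg : IsHolderClassOn s β g Ω) :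
    IsHolderClassOn s β (fun y => f y + g y) Ω := by
  refine ⟨hf.1.add hg.1, fun h0 k hk => ?_⟩
  obtain ⟨C, hC⟩ := hf.2 h0 k hk
  obtain ⟨D, hD⟩ := hg.2 h0 k hk
  subst hk
  refine ⟨C + D, fun y hy z hz => ?_⟩
  have key : ∀ y ∈ Ω, iteratedFDeriv ℝ k (fun y => f y + g y) y =
      iteratedFDeriv ℝ k f y + iteratedFDeriv ℝ k g y := fun y hy =>
    iteratedFDeriv_add_apply (hf.1.contDiffAt (hΩ.mem_nhds hy))
      (hg.1.contDiffAt (hΩ.mem_nhds hy))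
  rw [key y hy, key z hz]
  calc _ ≤ _ := edist_add_add_le _ _ _ _
    _ ≤ C * edist y z ^ (β : ℝ) + D * edist y z ^ (β : ℝ) :=
        add_le_add (hC y hy z hz) (hD y hy z hz)
    _ = _ := by push_cast; ring

end HolderCalculus

/-! ### Radial means: regularity and Euler's identity. -/

section RadialMean

universe u

variable {X F : Type u} [NormedAddCommGroup X] [NormedSpace ℝ X] [NormedAddCommGroup F]
  [NormedSpace ℝ F] {m : ℕ} {w : X → F} {R : ℝ} {y : X}

/-- The weighted mean `∫₀¹ tᵐ w(t y) dt` of `w` along the segment from the origin to `y`. -/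
def radialMean (m : ℕ) (w : X → F) (y : X) : F :=
  ∫ t in (0 : ℝ)..1, t ^ m • w (t • y)

theorem norm_smul_le_of_mem_Icc {t : ℝ} (ht : t ∈ Icc (0 : ℝ) 1) (y : X) : ‖t • y‖ ≤ ‖y‖ := by
  rw [norm_smul, Real.norm_of_nonneg ht.1]
  exact mul_le_of_le_one_left (norm_nonneg y) ht.2

theorem norm_pow_smul_le {t : ℝ} (ht : t ∈ Icc (0 : ℝ) 1) (m : ℕ) (x : F) :
    ‖t ^ m • x‖ ≤ ‖x‖ :=
  norm_smul_le_of_mem_Icc ⟨pow_nonneg ht.1 m, pow_le_one₀ ht.1 ht.2⟩ x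

theorem uIoc_subset_Icc {t : ℝ} (ht : t ∈ uIoc (0 : ℝ) 1) : t ∈ Icc (0 : ℝ) 1 := by
  rw [uIoc_of_le zero_le_one] at ht
  exact Ioc_subset_Icc_self ht

theorem smul_mem_ball_zero {t : ℝ} (ht : t ∈ Icc (0 : ℝ) 1) (hy : y ∈ Metric.ball (0 : X) R) :
    t • y ∈ Metric.ball (0 : X) R := by
  rw [mem_ball_zero_iff] at *
  exact (norm_smul_le_of_mem_Icc ht y).trans_lt hy

theorem continuousOn_radial (hw : ContinuousOn w (Metric.ball 0 R)) (m : ℕ)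
    (hy : y ∈ Metric.ball (0 : X) R) :
    ContinuousOn (fun t : ℝ => t ^ m • w (t • y)) (uIcc 0 1) := by
  rw [uIcc_of_le zero_le_one]
  refine (continuous_pow m).continuousOn.smul (hw.comp (by fun_prop) fun t ht => ?_)
  exact smul_mem_ball_zero ht hy

theorem aestronglyMeasurable_radial (hw : ContinuousOn w (Metric.ball 0 R)) (m : ℕ)
    (hy : y ∈ Metric.ball (0 : X) R) :
    MeasureTheory.AEStronglyMeasurable (fun t : ℝ => t ^ m • w (t • y))
      (MeasureTheory.volume.restrict (uIoc 0 1)) :=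
  ((continuousOn_radial hw m hy).mono uIoc_subset_uIcc).aestronglyMeasurable measurableSet_uIoc

/-- A field which is continuous on a ball is bounded on concentric smaller balls. -/
theorem exists_bound_near {X F : Type*} [NormedAddCommGroup X] [NormedAddCommGroup F]
    [ProperSpace X] {w : X → F} {R : ℝ} {y : X} (hw : ContinuousOn w (Metric.ball 0 R))
    (hy : y ∈ Metric.ball (0 : X) R) :
    ∃ r C : ℝ, y ∈ Metric.ball (0 : X) r ∧ r < R ∧ ∀ z ∈ Metric.ball (0 : X) r, ‖w z‖ ≤ C := by
  rw [mem_ball_zero_iff] at hy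
  obtain ⟨r, h1, h2⟩ := exists_between hy
  obtain ⟨C, hC⟩ := (isCompact_closedBall (0 : X) r).exists_bound_of_continuousOn
    (hw.mono (Metric.closedBall_subset_ball h2))
  exact ⟨r, C, by simpa using h1, h2, fun z hz => hC z (Metric.ball_subset_closedBall hz)⟩

theorem continuousAt_radialMean [ProperSpace X] (hw : ContinuousOn w (Metric.ball 0 R)) (m : ℕ)
    (hy : y ∈ Metric.ball (0 : X) R) : ContinuousAt (radialMean m w) y := by
  obtain ⟨r, C, hr, hrR, hC⟩ := exists_bound_near hw hy
  have hn := Metric.isOpen_ball.mem_nhds hr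
  refine intervalIntegral.continuousAt_of_dominated_interval (bound := fun _ => C) ?_ ?_
    (by simp) (Eventually.of_forall fun t ht => ?_)
  · filter_upwards [hn] with z hz
    exact aestronglyMeasurable_radial hw m (Metric.ball_subset_ball hrR.le hz)
  · filter_upwards [hn] with z hz
    exact Eventually.of_forall fun t ht => (norm_pow_smul_le (uIoc_subset_Icc ht) m _).trans
      (hC _ (smul_mem_ball_zero (uIoc_subset_Icc ht) hz))
  · have h1 : ContinuousAt w (t • y) :=
      hw.continuousAt (Metric.isOpen_ball.mem_nhds (smul_mem_ball_zero (uIoc_subset_Icc ht) hy))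
    have h2 : ContinuousAt (fun z : X => t • z) y := by fun_prop
    exact (ContinuousAt.comp (f := fun z : X => t • z) h1 h2).const_smul _

/-- Differentiating `w(ty)` in `y` produces one factor `t`, which raises the weight from `m` to `m +
1`. Domination comes from a bound of `Dw` on a smaller concentric ball. -/
theorem hasFDerivAt_radialMean [ProperSpace X] [CompleteSpace F]
    (hw : ∀ z ∈ Metric.ball (0 : X) R, ContDiffAt ℝ 1 w z) (m : ℕ)
    (hy : y ∈ Metric.ball (0 : X) R) :
    HasFDerivAt (radialMean m w) (radialMean (m + 1) (fderiv ℝ w) y) y := by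
  have hwc : ContinuousOn w (Metric.ball 0 R) := fun z hz =>
    (hw z hz).continuousAt.continuousWithinAt
  have hdc : ContinuousOn (fderiv ℝ w) (Metric.ball 0 R) := fun z hz =>
    ((hw z hz).continuousAt_fderiv (by simp)).continuousWithinAt
  obtain ⟨r, C, hr, hrR, hC⟩ := exists_bound_near hdc hy
  have hn := Metric.isOpen_ball.mem_nhds hr
  refine intervalIntegral.hasFDerivAt_integral_of_dominated_of_fderiv_le
    (F := fun z (t : ℝ) => t ^ m • w (t • z))
    (F' := fun z (t : ℝ) => t ^ (m + 1) • fderiv ℝ w (t • z)) (bound := fun _ => C)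
    hn ?_ (continuousOn_radial hwc m hy).intervalIntegrable
    (aestronglyMeasurable_radial hdc _ hy) ?_ (by simp) ?_
  · filter_upwards [hn] with z hz
    exact aestronglyMeasurable_radial hwc m (Metric.ball_subset_ball hrR.le hz)
  · exact Eventually.of_forall fun t ht z hz => (norm_pow_smul_le (uIoc_subset_Icc ht) _ _).trans
      (hC _ (smul_mem_ball_zero (uIoc_subset_Icc ht) hz))
  · refine Eventually.of_forall fun t ht z hz => ?_
    have h1 : HasFDerivAt w (fderiv ℝ w (t • z)) (t • z) :=
      ((hw _ (smul_mem_ball_zero (uIoc_subset_Icc ht)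
        (Metric.ball_subset_ball hrR.le hz))).differentiableAt (by simp)).hasFDerivAt
    have h2 : HasFDerivAt (fun x : X => t • x) (t • ContinuousLinearMap.id ℝ X) z :=
      (hasFDerivAt_id z).const_smul t
    have h3 := (HasFDerivAt.comp (f := fun x : X => t • x) z h1 h2).const_smul (t ^ m)
    refine h3.congr_fderiv ?_
    ext x
    simp [pow_succ, smul_smul]

theorem fderiv_radialMean_eventuallyEq [ProperSpace X] [CompleteSpace F]
    (hw : ∀ z ∈ Metric.ball (0 : X) R, ContDiffAt ℝ 1 w z) (m : ℕ)
    (hy : y ∈ Metric.ball (0 : X) R) :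
    fderiv ℝ (radialMean m w) =ᶠ[𝓝 y] radialMean (m + 1) (fderiv ℝ w) := by
  filter_upwards [Metric.isOpen_ball.mem_nhds hy] with z hz
  exact (hasFDerivAt_radialMean hw m hz).fderiv

theorem contDiffAt_radialMean_nat [ProperSpace X] [CompleteSpace F] {k : ℕ}
    (hw : ∀ z ∈ Metric.ball (0 : X) R, ContDiffAt ℝ k w z) (m : ℕ)
    (hy : y ∈ Metric.ball (0 : X) R) : ContDiffAt ℝ k (radialMean m w) y := by
  induction k generalizing F m y with
  | zero =>
    have hwc : ContinuousOn w (Metric.ball 0 R) := fun z hz =>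
      (hw z hz).continuousAt.continuousWithinAt
    refine contDiffAt_zero.2 ⟨_, Metric.isOpen_ball.mem_nhds hy, fun z hz =>
      (continuousAt_radialMean hwc m hz).continuousWithinAt⟩
  | succ k ih =>
    have hw1 : ∀ z ∈ Metric.ball (0 : X) R, ContDiffAt ℝ 1 w z := fun z hz =>
      (hw z hz).of_le (by exact_mod_cast Nat.le_add_left 1 k)
    push_cast
    refine contDiffAt_succ_iff_hasFDerivAt.2 ⟨radialMean (m + 1) (fderiv ℝ w),
      ⟨_, Metric.isOpen_ball.mem_nhds hy, fun z hz => hasFDerivAt_radialMean hw1 m hz⟩,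
      ih (fun z hz => (hw z hz).fderiv_right (by simp)) _ hy⟩

/-- A single Hölder constant is needed along whole segments to the origin, so it is taken on a
compact concentric ball. Dilations by `t ≤ 1` and weights `t ^ m ≤ 1` do not increase it. -/
theorem locallyHolderAt_radialMean [ProperSpace X] {β : ℝ≥0} (hβ : 0 < β)
    (hw : ∀ z ∈ Metric.ball (0 : X) R, LocallyHolderAt β w z) (m : ℕ)
    (hy : y ∈ Metric.ball (0 : X) R) : LocallyHolderAt β (radialMean m w) y := by
  have hwc : ContinuousOn w (Metric.ball 0 R) := fun z hz => by
    obtain ⟨C, u, hu, hC⟩ := hw z hz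
    exact ((hC.continuousOn hβ).continuousAt hu).continuousWithinAt
  obtain ⟨r, h1, h2⟩ := exists_between (mem_ball_zero_iff.1 hy)
  obtain ⟨C, hC⟩ := exists_holderOnWith_of_isCompact (isCompact_closedBall (0 : X) r) hβ
    fun z hz => hw z (Metric.closedBall_subset_ball h2 hz)
  refine ⟨C, _, Metric.isOpen_ball.mem_nhds (mem_ball_zero_iff.2 h1), fun a ha b hb => ?_⟩
  rw [edist_nndist, edist_nndist, ← ENNReal.coe_rpow_of_nonneg _ β.coe_nonneg]
  norm_cast
  rw [← NNReal.coe_le_coe]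
  push_cast
  have hs := Metric.ball_subset_ball (x := (0 : X)) h2.le
  rw [dist_eq_norm, radialMean, radialMean, ← intervalIntegral.integral_sub
    (continuousOn_radial hwc m (hs ha)).intervalIntegrable
    (continuousOn_radial hwc m (hs hb)).intervalIntegrable]
  refine (intervalIntegral.norm_integral_le_of_norm_le_const
    (C := C * dist a b ^ (β : ℝ)) fun t ht => ?_).trans_eq (by simp)
  have ht' := uIoc_subset_Icc ht
  rw [← smul_sub]
  refine (norm_pow_smul_le ht' m _).trans ?_
  rw [← dist_eq_norm]
  refine (hC.dist_le (Metric.ball_subset_closedBall (smul_mem_ball_zero ht' ha))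
    (Metric.ball_subset_closedBall (smul_mem_ball_zero ht' hb))).trans ?_
  gcongr
  rw [dist_eq_norm, dist_eq_norm, ← smul_sub]
  exact norm_smul_le_of_mem_Icc ht' _

theorem IsHolderAt.radialMean [ProperSpace X] [CompleteSpace F] {β : ℝ≥0} {k : ℕ} (hβ : 0 < β)
    (hw : ∀ z ∈ Metric.ball (0 : X) R, IsHolderAt k β w z) (m : ℕ)
    (hy : y ∈ Metric.ball (0 : X) R) : IsHolderAt k β (radialMean m w) y := by
  induction k generalizing F m y with
  | zero =>
    refine isHolderAt_zero.2 ⟨?_, locallyHolderAt_radialMean hβ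
      (fun z hz => (isHolderAt_zero.1 (hw z hz)).2) m hy⟩
    exact_mod_cast contDiffAt_radialMean_nat (fun z hz => (hw z hz).1) m hy
  | succ k ih =>
    have h1 : ∀ z ∈ Metric.ball (0 : X) R, ContDiffAt ℝ 1 w z := fun z hz =>
      (hw z hz).1.of_le (by exact_mod_cast Nat.le_add_left 1 k)
    refine isHolderAt_succ.2 ⟨?_, ?_⟩
    · exact_mod_cast contDiffAt_radialMean_nat (fun z hz => (hw z hz).1) m hy
    · exact (ih (fun z hz => (isHolderAt_succ.1 (hw z hz)).2) (m + 1) hy).congr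
        (fderiv_radialMean_eventuallyEq h1 m hy)

theorem IsHolderClassAt.radialMean [ProperSpace X] [CompleteSpace F] {β : ℝ≥0} {s : ℕ∞}
    (hw : ∀ z ∈ Metric.ball (0 : X) R, IsHolderClassAt s β w z) (m : ℕ)
    (hy : y ∈ Metric.ball (0 : X) R) : IsHolderClassAt s β (radialMean m w) y := by
  refine ⟨?_, fun h0 k hk => .radialMean h0 (fun z hz => (hw z hz).2 h0 k hk) m hy⟩
  induction s using ENat.recTopCoe with
  | top =>
    exact contDiffAt_infty.2 fun k => contDiffAt_radialMean_nat
      (fun z hz => contDiffAt_infty.1 (hw z hz).1 k) m hy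
  | coe k => exact contDiffAt_radialMean_nat (fun z hz => (hw z hz).1) m hy

theorem norm_radialMean_le {C : ℝ} (hC : ∀ t ∈ Icc (0 : ℝ) 1, ‖w (t • y)‖ ≤ C) :
    ‖radialMean m w y‖ ≤ C := by
  refine (intervalIntegral.norm_integral_le_of_norm_le_const (C := C)
    fun t ht => ?_).trans_eq (by simp)
  exact (norm_pow_smul_le (uIoc_subset_Icc ht) m _).trans (hC t (uIoc_subset_Icc ht))

/-- Euler's identity for the radial mean: integration by parts along the segment from the
origin to `y`. -/
theorem radialMean_fderiv_apply_self [CompleteSpace F]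
    (hw : ∀ z ∈ Metric.ball (0 : X) R, ContDiffAt ℝ 1 w z) (m : ℕ)
    (hy : y ∈ Metric.ball (0 : X) R) :
    radialMean (m + 1) (fderiv ℝ w) y y = w y - (m + 1 : ℝ) • radialMean m w y := by
  have hwc : ContinuousOn w (Metric.ball 0 R) := fun z hz =>
    (hw z hz).continuousAt.continuousWithinAt
  have hdc : ContinuousOn (fderiv ℝ w) (Metric.ball 0 R) := fun z hz =>
    ((hw z hz).continuousAt_fderiv (by simp)).continuousWithinAt
  have hi1 := (continuousOn_radial hwc m hy).intervalIntegrable (μ := MeasureTheory.volume)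
  have hi2 := (continuousOn_radial hdc (m + 1) hy).intervalIntegrable
    (μ := MeasureTheory.volume)
  have hi3 : IntervalIntegrable (fun t : ℝ => t ^ (m + 1) • fderiv ℝ w (t • y) y)
      MeasureTheory.volume 0 1 :=
    ((continuousOn_radial hdc (m + 1) hy).clm_apply continuousOn_const).intervalIntegrable
  -- The identity is the fundamental theorem of calculus for `t^(m+1) w(ty)`, which vanishes at `t =
  -- 0` and equals `w y` at `t = 1`.
  have hd : ∀ t ∈ uIcc (0 : ℝ) 1, HasDerivAt (fun t : ℝ => t ^ (m + 1) • w (t • y))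
      (t ^ (m + 1) • fderiv ℝ w (t • y) y + (m + 1 : ℝ) • t ^ m • w (t • y)) t := by
    intro t ht
    rw [uIcc_of_le zero_le_one] at ht
    have h1 : HasFDerivAt w (fderiv ℝ w (t • y)) (t • y) :=
      ((hw _ (smul_mem_ball_zero ht hy)).differentiableAt (by simp)).hasFDerivAt
    have h2 : HasDerivAt (fun t : ℝ => t • y) y t := by
      simpa using (hasDerivAt_id t).smul_const y
    have h3 := (hasDerivAt_pow (m + 1) t).smul (h1.comp_hasDerivAt t h2)
    refine h3.congr_deriv ?_
    simp [smul_smul]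
  have hi4 : IntervalIntegrable (fun t : ℝ => (m + 1 : ℝ) • t ^ m • w (t • y))
      MeasureTheory.volume 0 1 := hi1.smul _
  have h := intervalIntegral.integral_eq_sub_of_hasDerivAt hd (hi3.add hi4)
  rw [intervalIntegral.integral_add hi3 hi4, intervalIntegral.integral_smul] at h
  have h4 : radialMean (m + 1) (fderiv ℝ w) y y =
      ∫ t in (0 : ℝ)..1, t ^ (m + 1) • fderiv ℝ w (t • y) y := by
    rw [radialMean, ← ContinuousLinearMap.apply_apply (𝕜 := ℝ) y,
      ← ContinuousLinearMap.intervalIntegral_comp_comm _ hi2]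
    simp
  rw [h4, eq_sub_iff_add_eq]
  simpa [radialMean] using h

end RadialMean

/-! ### Divergence-free cutoff in Euclidean space. -/

section Cutoff

variable {n : ℕ}

/-- The divergence of a vector field on `ℝⁿ`. -/
def euclDiv (u : E n → E n) (z : E n) : ℝ :=
  LinearMap.trace ℝ (E n) (fderiv ℝ u z).toLinearMap

/-- The trace as a continuous linear functional. -/
def traceCLM (n : ℕ) : (E n →L[ℝ] E n) →L[ℝ] ℝ :=
  LinearMap.toContinuousLinearMap
    ((LinearMap.trace ℝ (E n)).comp (ContinuousLinearMap.coeLM ℝ))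

theorem traceCLM_apply (A : E n →L[ℝ] E n) :
    traceCLM n A = LinearMap.trace ℝ (E n) A.toLinearMap := rfl

theorem traceCLM_smulRight (f : E n →L[ℝ] ℝ) (x : E n) : traceCLM n (f.smulRight x) = f x := by
  rw [traceCLM_apply]
  exact LinearMap.trace_smulRight f.toLinearMap x

theorem traceCLM_id : traceCLM n (ContinuousLinearMap.id ℝ (E n)) = n := by
  rw [traceCLM_apply]
  simp

theorem euclDiv_add {u v : E n → E n} {z : E n} (hu : DifferentiableAt ℝ u z)
    (hv : DifferentiableAt ℝ v z) :
    euclDiv (fun y => u y + v y) z = euclDiv u z + euclDiv v z := by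
  simp only [euclDiv, ← traceCLM_apply]
  rw [fderiv_fun_add hu hv, map_add]

theorem euclDiv_sub {u v : E n → E n} {z : E n} (hu : DifferentiableAt ℝ u z)
    (hv : DifferentiableAt ℝ v z) :
    euclDiv (fun y => u y - v y) z = euclDiv u z - euclDiv v z := by
  simp only [euclDiv, ← traceCLM_apply]
  rw [fderiv_fun_sub hu hv, map_sub]

theorem euclDiv_smul {a : E n → ℝ} {u : E n → E n} {z : E n} (ha : DifferentiableAt ℝ a z)
    (hu : DifferentiableAt ℝ u z) :
    euclDiv (fun y => a y • u y) z = a z * euclDiv u z + fderiv ℝ a z (u z) := by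
  simp only [euclDiv, ← traceCLM_apply]
  rw [fderiv_fun_smul ha hu, map_add, map_smul, traceCLM_smulRight, smul_eq_mul]

theorem euclDiv_id (z : E n) : euclDiv (fun y : E n => y) z = n := by
  rw [euclDiv, ← traceCLM_apply, fderiv_fun_id, traceCLM_id]

theorem euclDiv_congr {u v : E n → E n} {z : E n} (h : u =ᶠ[𝓝 z] v) :
    euclDiv u z = euclDiv v z := by
  rw [euclDiv, euclDiv, h.fderiv_eq]

/-- A smooth profile equal to `1` on `(-∞, 1/2]` and to `0` on `[1, ∞)`. -/
def profile (t : ℝ) : ℝ := Real.smoothTransition (2 - 2 * t)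

theorem contDiff_profile : ContDiff ℝ ∞ profile :=
  Real.smoothTransition.contDiff.comp (by fun_prop)

theorem contDiff_deriv_profile : ContDiff ℝ ∞ (deriv profile) :=
  contDiff_profile.deriv'

theorem profile_of_le {t : ℝ} (ht : t ≤ 1 / 2) : profile t = 1 :=
  Real.smoothTransition.one_of_one_le (by linarith)

theorem profile_of_ge {t : ℝ} (ht : 1 ≤ t) : profile t = 0 :=
  Real.smoothTransition.zero_of_nonpos (by linarith)

theorem deriv_profile_of_lt {t : ℝ} (ht : t < 1 / 2) : deriv profile t = 0 := by
  have : profile =ᶠ[𝓝 t] fun _ => 1 := by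
    filter_upwards [Iio_mem_nhds ht] with x hx using profile_of_le (le_of_lt hx)
  rw [this.deriv_eq, deriv_const]

/-- At the endpoint `t = 1` this follows by continuity of the derivative. -/
theorem deriv_profile_of_ge {t : ℝ} (ht : 1 ≤ t) : deriv profile t = 0 := by
  have h1 : ∀ x ∈ Ioi (1 : ℝ), deriv profile x = 0 := fun x hx => by
    have : profile =ᶠ[𝓝 x] fun _ => 0 := by
      filter_upwards [Ioi_mem_nhds hx] with x hx using profile_of_ge (le_of_lt hx)
    rw [this.deriv_eq, deriv_const]
  have h2 : IsClosed {x | deriv profile x = 0} :=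
    isClosed_eq contDiff_deriv_profile.continuous continuous_const
  have h3 : closure (Ioi (1 : ℝ)) ⊆ {x | deriv profile x = 0} := h2.closure_subset_iff.2 h1
  rw [closure_Ioi] at h3
  exact h3 ht

/-- The smooth cutoff function of the unit ball. -/
def cutoff (z : E n) : ℝ := profile (‖z‖ ^ 2)

/-- The operator `2 g'(|z|²) (|z|² - z ⊗ z)`, where `g` is the cutoff profile. -/
def cutoffOp (z : E n) : E n →L[ℝ] E n :=
  (2 * deriv profile (‖z‖ ^ 2)) •
    (‖z‖ ^ 2 • ContinuousLinearMap.id ℝ (E n) - (innerSL ℝ z).smulRight z)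

theorem contDiff_cutoff : ContDiff ℝ ∞ (cutoff (n := n)) :=
  contDiff_profile.comp (contDiff_norm_sq ℝ)

theorem contDiff_cutoffOp : ContDiff ℝ ∞ (cutoffOp (n := n)) := by
  have h1 : ContDiff ℝ ∞ fun z : E n => deriv profile (‖z‖ ^ 2) :=
    contDiff_deriv_profile.comp (contDiff_norm_sq ℝ)
  have h2 : ContDiff ℝ ∞ fun z : E n => ‖z‖ ^ 2 := contDiff_norm_sq ℝ
  have h3 : ContDiff ℝ ∞ fun z : E n => (innerSL ℝ z).smulRight z :=
    ContDiff.smulRight (innerSL ℝ).contDiff contDiff_id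
  exact (contDiff_const.mul h1).smul ((h2.smul contDiff_const).sub h3)

theorem cutoff_of_ge {z : E n} (hz : 1 ≤ ‖z‖) : cutoff z = 0 :=
  profile_of_ge (one_le_pow₀ hz)

theorem cutoffOp_of_ge {z : E n} (hz : 1 ≤ ‖z‖) : cutoffOp z = 0 := by
  rw [cutoffOp, deriv_profile_of_ge (one_le_pow₀ hz), mul_zero]
  exact zero_smul ℝ (_ : E n →L[ℝ] E n)

theorem hasCompactSupport_of_norm_ge {F : Type*} [NormedAddCommGroup F] {f : E n → F}
    (hf : ∀ z, 1 ≤ ‖z‖ → f z = 0) : HasCompactSupport f := by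
  refine HasCompactSupport.intro (isCompact_closedBall (0 : E n) 1) fun z hz => hf z ?_
  rw [mem_closedBall_zero_iff, not_le] at hz
  exact hz.le

/-- The divergence-free localization of a divergence-free field `w` to the unit ball. -/
def localize (w : E n → E n) (z : E n) : E n :=
  cutoff z • w z + cutoffOp z (radialMean (n - 2) w z)

theorem localize_of_ge {w : E n → E n} {z : E n} (hz : 1 ≤ ‖z‖) : localize w z = 0 := by
  simp [localize, cutoff_of_ge hz, cutoffOp_of_ge hz]

theorem localize_eventuallyEq_zero {w : E n → E n} {z : E n} (hz : 1 < ‖z‖) :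
    localize w =ᶠ[𝓝 z] fun _ => 0 := by
  filter_upwards [continuous_norm.continuousAt.eventually_const_lt hz] with y hy
  exact localize_of_ge hy.le

theorem localize_eventuallyEq (w : E n → E n) : localize w =ᶠ[𝓝 0] w := by
  have h : ∀ᶠ z : E n in 𝓝 0, ‖z‖ ^ 2 < 1 / 2 :=
    (continuous_norm.pow 2).continuousAt.eventually_lt_const (by simp)
  filter_upwards [h] with z hz
  simp [localize, cutoff, cutoffOp, profile_of_le hz.le, deriv_profile_of_lt hz]

/-- The open sets `‖z‖ < 2` and `‖z‖ > 1` cover the space: on the first `w` is controlled, on the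
second the localization is zero. Hence the assumption on a ball of radius `2`. -/
theorem isHolderClassAt_localize {w : E n → E n} {s : ℕ∞} {β : ℝ≥0} (hβ : β ≤ 1)
    (hw : ∀ z ∈ Metric.ball (0 : E n) 2, IsHolderClassAt s β w z) (z : E n) :
    IsHolderClassAt s β (localize w) z := by
  rcases lt_or_ge ‖z‖ 2 with hz | hz
  · have hz' : z ∈ Metric.ball (0 : E n) 2 := mem_ball_zero_iff.2 hz
    have h1 : IsHolderClassAt s β (cutoff (n := n)) z :=
      .of_contDiffAt hβ contDiff_cutoff.contDiffAt
    have h2 : IsHolderClassAt s β (cutoffOp (n := n)) z :=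
      .of_contDiffAt hβ contDiff_cutoffOp.contDiffAt
    exact (h1.clm₂ hβ (ContinuousLinearMap.lsmul ℝ ℝ) (hw z hz')).add
      (h2.clm_apply hβ (.radialMean hw (n - 2) hz'))
  · exact (IsHolderClassAt.of_contDiffAt hβ contDiffAt_const).congr
      (localize_eventuallyEq_zero (by linarith))

/-- Zero divergence passes to radial means because the trace commutes with the integral. -/
theorem trace_radialMean_fderiv {w : E n → E n} {m : ℕ} {z : E n} {R : ℝ}
    (hw : ∀ z ∈ Metric.ball (0 : E n) R, ContDiffAt ℝ 1 w z)
    (hd : ∀ z ∈ Metric.ball (0 : E n) R, euclDiv w z = 0) (hz : z ∈ Metric.ball (0 : E n) R) :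
    traceCLM n (radialMean m (fderiv ℝ w) z) = 0 := by
  have hdc : ContinuousOn (fderiv ℝ w) (Metric.ball 0 R) := fun z hz =>
    ((hw z hz).continuousAt_fderiv (by simp)).continuousWithinAt
  rw [radialMean, ← ContinuousLinearMap.intervalIntegral_comp_comm _
    (continuousOn_radial hdc m hz).intervalIntegrable]
  have h : EqOn (fun t : ℝ => traceCLM n (t ^ m • fderiv ℝ w (t • z))) (fun _ => 0)
      (uIcc 0 1) := fun t ht => by
    rw [uIcc_of_le zero_le_one] at ht
    have : traceCLM n (fderiv ℝ w (t • z)) = 0 := hd _ (smul_mem_ball_zero ht hz)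
    simp [this]
  rw [intervalIntegral.integral_congr h]
  simp

/-- Put `k = 2g'(|z|²)` and `P = |z|² b - ⟨b, z⟩ z`. The divergence of `g w` is `k⟨z, w⟩`. As `P` is
orthogonal to `z` and `k` is radial, the divergence of `k P` is `k div P`. Euler's identity for `b`
gives `div P = -⟨z, w⟩`, and the two terms cancel. -/
theorem euclDiv_localize (hn : 2 ≤ n) {w : E n → E n}
    (hw : ∀ z ∈ Metric.ball (0 : E n) 2, ContDiffAt ℝ 1 w z)
    (hd : ∀ z ∈ Metric.ball (0 : E n) 2, euclDiv w z = 0) (z : E n) :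
    euclDiv (localize w) z = 0 := by
  rcases lt_or_ge ‖z‖ 2 with hz | hz
  swap
  · rw [euclDiv_congr (localize_eventuallyEq_zero (by linarith)), euclDiv]
    simp
  have hz' : z ∈ Metric.ball (0 : E n) 2 := mem_ball_zero_iff.2 hz
  set b := radialMean (n - 2) w with hb
  have hbd := hasFDerivAt_radialMean hw (n - 2) hz'
  have hbdiff : DifferentiableAt ℝ b z := hbd.differentiableAt
  have hwdiff : DifferentiableAt ℝ w z := (hw z hz').differentiableAt (by simp)
  have hbdiv : euclDiv b z = 0 := by
    rw [euclDiv, hbd.fderiv]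
    exact trace_radialMean_fderiv hw hd hz'
  -- The weight `n - 2` yields the factor `(n - 2) + 1 = n - 1`, the one that cancels the multiples
  -- of `⟨b, z⟩` in `div P`. The natural subtraction is genuine by `hn`.
  have heuler : fderiv ℝ b z z = w z - ((n : ℝ) - 1) • b z := by
    rw [hbd.fderiv, radialMean_fderiv_apply_self hw (n - 2) hz', Nat.cast_sub hn]
    congr 2
    push_cast
    ring
  have hsq : HasFDerivAt (fun y : E n => ‖y‖ ^ 2) (2 • innerSL ℝ z) z :=
    (hasStrictFDerivAt_norm_sq z).hasFDerivAt
  have hcut : HasFDerivAt (cutoff (n := n)) (deriv profile (‖z‖ ^ 2) • 2 • innerSL ℝ z) z :=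
    ((contDiff_profile.differentiable (by simp)).differentiableAt.hasDerivAt).comp_hasFDerivAt z hsq
  have hk : HasFDerivAt (fun y : E n => 2 * deriv profile (‖y‖ ^ 2))
      ((2 : ℝ) • deriv (deriv profile) (‖z‖ ^ 2) • 2 • innerSL ℝ z) z :=
    ((contDiff_deriv_profile.differentiable
      (by simp)).differentiableAt.hasDerivAt.comp_hasFDerivAt z hsq).const_mul 2
  have hinner : DifferentiableAt ℝ (fun y => inner ℝ (b y) y) z :=
    hbdiff.inner ℝ differentiableAt_fun_id
  have hPdiff : DifferentiableAt ℝ (fun y => ‖y‖ ^ 2 • b y - inner ℝ (b y) y • y) z :=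
    (hsq.differentiableAt.fun_smul hbdiff).sub (hinner.fun_smul differentiableAt_fun_id)
  have hP : euclDiv (fun y => ‖y‖ ^ 2 • b y - inner ℝ (b y) y • y) z = - inner ℝ z (w z) := by
    rw [euclDiv_sub (hsq.differentiableAt.fun_smul hbdiff)
        (hinner.fun_smul differentiableAt_fun_id),
      euclDiv_smul hsq.differentiableAt hbdiff, euclDiv_smul hinner differentiableAt_fun_id,
      euclDiv_id, hbdiv, hsq.fderiv, fderiv_inner_apply ℝ hbdiff differentiableAt_fun_id]
    simp only [fderiv_fun_id, heuler, ContinuousLinearMap.id_apply, real_inner_comm z]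
    simp [inner_sub_right, inner_smul_right]
    ring
  have hform : localize w = fun y => cutoff y • w y +
      (2 * deriv profile (‖y‖ ^ 2)) • (‖y‖ ^ 2 • b y - inner ℝ (b y) y • y) := by
    funext y
    simp [localize, cutoffOp, hb, real_inner_comm y]
  rw [hform, euclDiv_add (hcut.differentiableAt.fun_smul hwdiff)
      (hk.differentiableAt.fun_smul hPdiff),
    euclDiv_smul hcut.differentiableAt hwdiff, euclDiv_smul hk.differentiableAt hPdiff,
    hP, hd z hz', hcut.fderiv, hk.fderiv]
  simp [inner_sub_right, inner_smul_right, real_inner_comm z]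
  ring

theorem exists_bound_of_contDiff {F : Type*} [NormedAddCommGroup F] [NormedSpace ℝ F]
    {f : E n → F} (hf : ContDiff ℝ ∞ f) (h0 : ∀ z, 1 ≤ ‖z‖ → f z = 0) :
    ∃ K : ℝ, 0 ≤ K ∧ ∀ z, ‖f z‖ ≤ K ∧ ‖fderiv ℝ f z‖ ≤ K := by
  have h := hasCompactSupport_of_norm_ge h0
  obtain ⟨K, hK⟩ := h.exists_bound_of_continuous hf.continuous
  obtain ⟨L, hL⟩ := (h.fderiv ℝ).exists_bound_of_continuous (hf.continuous_fderiv (by simp))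
  exact ⟨max K L, le_max_of_le_left ((norm_nonneg _).trans (hK 0)), fun z =>
    ⟨le_max_of_le_left (hK z), le_max_of_le_right (hL z)⟩⟩

theorem exists_cutoff_bound (n : ℕ) : ∃ K : ℝ, 0 < K ∧ ∀ z : E n,
    ‖cutoff z‖ ≤ K ∧ ‖fderiv ℝ (cutoff (n := n)) z‖ ≤ K ∧ ‖cutoffOp z‖ ≤ K ∧
      ‖fderiv ℝ (cutoffOp (n := n)) z‖ ≤ K := by
  obtain ⟨K, hK, hK1⟩ := exists_bound_of_contDiff (contDiff_cutoff (n := n))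
    fun _ => cutoff_of_ge
  obtain ⟨L, hL, hL1⟩ := exists_bound_of_contDiff (contDiff_cutoffOp (n := n))
    fun _ => cutoffOp_of_ge
  have h1 : K ≤ K + L + 1 := by linarith
  have h2 : L ≤ K + L + 1 := by linarith
  exact ⟨K + L + 1, by positivity, fun z => ⟨(hK1 z).1.trans h1, (hK1 z).2.trans h1,
    (hL1 z).1.trans h2, (hL1 z).2.trans h2⟩⟩

/-- `C¹` bounds for the localization of a field with small derivative. -/
theorem exists_localize_bound (n : ℕ) : ∃ K : ℝ, 0 < K ∧ ∀ (w : E n → E n) (δ : ℝ),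
    (∀ z ∈ Metric.ball (0 : E n) 2, ContDiffAt ℝ 1 w z) → w 0 = 0 →
    (∀ z ∈ Metric.ball (0 : E n) 2, ‖fderiv ℝ w z‖ ≤ δ) → ∀ z,
      ‖localize w z‖ ≤ K * δ ∧ ‖fderiv ℝ (localize w) z‖ ≤ K * δ := by
  obtain ⟨K, hK, hKb⟩ := exists_cutoff_bound n
  -- Each of the two products contributes `K δ + 2 K δ` to the derivative, since `‖Dw‖ ≤ δ` and `‖w‖
  -- ≤ 2 δ` on the ball of radius `2`, and likewise for the radial mean.
  refine ⟨6 * K, by positivity, fun w δ hw h0 hδ z => ?_⟩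
  have hδ0 : 0 ≤ δ := (norm_nonneg _).trans (hδ 0 (by simp))
  rcases lt_or_ge ‖z‖ 2 with hz | hz
  swap
  · have h := localize_eventuallyEq_zero (w := w) (z := z) (by linarith)
    rw [h.fderiv_eq, localize_of_ge (by linarith)]
    have : 0 ≤ 6 * K * δ := by positivity
    simp [this]
  have hz' : z ∈ Metric.ball (0 : E n) 2 := mem_ball_zero_iff.2 hz
  obtain ⟨k1, k2, k3, k4⟩ := hKb z
  have hwb : ∀ y ∈ Metric.ball (0 : E n) 2, ‖w y‖ ≤ δ * ‖y‖ := fun y hy => by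
    have := Convex.norm_image_sub_le_of_norm_fderiv_le (𝕜 := ℝ)
      (fun x hx => (hw x hx).differentiableAt (by simp)) hδ (convex_ball (0 : E n) 2)
      (by simp : (0 : E n) ∈ Metric.ball (0 : E n) 2) hy
    simpa [h0] using this
  have hw2 : ∀ y ∈ Metric.ball (0 : E n) 2, ‖w y‖ ≤ 2 * δ := fun y hy =>
    (hwb y hy).trans (by
      have := (mem_ball_zero_iff.1 hy).le
      nlinarith)
  have hb2 : ‖radialMean (n - 2) w z‖ ≤ 2 * δ :=
    norm_radialMean_le fun t ht => hw2 _ (smul_mem_ball_zero ht hz')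
  have hb' : ‖radialMean (n - 2 + 1) (fderiv ℝ w) z‖ ≤ δ :=
    norm_radialMean_le fun t ht => hδ _ (smul_mem_ball_zero ht hz')
  have hbd := hasFDerivAt_radialMean hw (n - 2) hz'
  have hwd : HasFDerivAt w (fderiv ℝ w z) z := ((hw z hz').differentiableAt (by simp)).hasFDerivAt
  have hcd : HasFDerivAt (cutoff (n := n)) (fderiv ℝ cutoff z) z :=
    ((contDiff_cutoff.differentiable (by simp)) z).hasFDerivAt
  have hLd : HasFDerivAt (cutoffOp (n := n)) (fderiv ℝ cutoffOp z) z :=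
    ((contDiff_cutoffOp.differentiable (by simp)) z).hasFDerivAt
  have hF := (hcd.smul hwd).add (hLd.clm_apply hbd)
  constructor
  · calc ‖localize w z‖ ≤ ‖cutoff z • w z‖ + ‖cutoffOp z (radialMean (n - 2) w z)‖ :=
          norm_add_le _ _
      _ ≤ K * (2 * δ) + K * (2 * δ) := by
        refine add_le_add ?_ ((cutoffOp z).le_of_opNorm_le_of_le k3 hb2)
        rw [norm_smul]
        exact mul_le_mul k1 (hw2 z hz') (norm_nonneg _) hK.le
      _ ≤ 6 * K * δ := by nlinarith [mul_nonneg hK.le hδ0]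
  · have hF' : HasFDerivAt (localize w) _ z := hF
    rw [hF'.fderiv]
    refine ContinuousLinearMap.opNorm_le_bound _ (by positivity) fun x => ?_
    have e1 : ‖cutoff z • fderiv ℝ w z x‖ ≤ K * (δ * ‖x‖) := by
      rw [norm_smul]
      exact mul_le_mul k1 ((fderiv ℝ w z).le_of_opNorm_le (hδ z hz') x) (norm_nonneg _) hK.le
    have e2 : ‖fderiv ℝ cutoff z x • w z‖ ≤ (K * ‖x‖) * (2 * δ) := by
      rw [norm_smul]
      exact mul_le_mul ((fderiv ℝ cutoff z).le_of_opNorm_le k2 x) (hw2 z hz') (norm_nonneg _)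
        (by positivity)
    have e3 : ‖cutoffOp z (radialMean (n - 2 + 1) (fderiv ℝ w) z x)‖ ≤ K * (δ * ‖x‖) :=
      (cutoffOp z).le_of_opNorm_le_of_le k3 (ContinuousLinearMap.le_of_opNorm_le _ hb' x)
    have e4 : ‖fderiv ℝ cutoffOp z x (radialMean (n - 2) w z)‖ ≤ (K * ‖x‖) * (2 * δ) :=
      ContinuousLinearMap.le_of_opNorm_le_of_le _
        ((fderiv ℝ cutoffOp z).le_of_opNorm_le k4 x) hb2
    have e5 := norm_add_le (cutoff z • fderiv ℝ w z x + fderiv ℝ cutoff z x • w z)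
      (cutoffOp z (radialMean (n - 2 + 1) (fderiv ℝ w) z x) +
        fderiv ℝ cutoffOp z x (radialMean (n - 2) w z))
    have e6 := norm_add_le (cutoff z • fderiv ℝ w z x) (fderiv ℝ cutoff z x • w z)
    have e7 := norm_add_le (cutoffOp z (radialMean (n - 2 + 1) (fderiv ℝ w) z x))
      (fderiv ℝ cutoffOp z x (radialMean (n - 2) w z))
    refine le_trans (le_of_eq ?_) (e5.trans (b := _) (c := 6 * K * δ * ‖x‖) (by linarith))
    simp

/-- Divergence-free fields on `ℝⁿ` which vanish at `p` can be localized to balls of centre `p`,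
with a loss of a factor `K` in the `C¹` bounds. -/
def IsLocalizationConstant (n : ℕ) (K : ℝ) : Prop :=
  ∀ (s : ℕ∞) (β : ℝ≥0), 1 ≤ s → β ≤ 1 → ∀ (u : E n → E n) (p : E n) (r δ : ℝ), 0 < r →
    (∀ y ∈ Metric.ball p (2 * r), IsHolderClassAt s β u y) → u p = 0 →
    (∀ y ∈ Metric.ball p (2 * r), euclDiv u y = 0) →
    (∀ y ∈ Metric.ball p (2 * r), ‖fderiv ℝ u y‖ ≤ δ) →
    ∃ G : E n → E n, (∀ y, IsHolderClassAt s β G y) ∧ (∀ y, euclDiv G y = 0) ∧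
      G =ᶠ[𝓝 p] u ∧ (∀ y ∉ Metric.closedBall p r, G y = 0) ∧
      ∀ y, ‖G y‖ ≤ r * (K * δ) ∧ ‖fderiv ℝ G y‖ ≤ K * δ

/-- Rescaling to radius one by `w(z) = u(p + rz)/r` leaves the derivative and its trace unchanged,
so `K` does not depend on `r`; undoing it multiplies the sup norm of the field by `r`. -/
theorem exists_isLocalizationConstant {n : ℕ} (hn : 2 ≤ n) :
    ∃ K : ℝ, 0 < K ∧ IsLocalizationConstant n K := by
  obtain ⟨K, hK, hKb⟩ := exists_localize_bound n
  refine ⟨K, hK, fun s β hs hβ u p r δ hr hu hp hd hδ => ?_⟩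
  have hmaps : ∀ z ∈ Metric.ball (0 : E n) 2, p + r • z ∈ Metric.ball p (2 * r) := fun z hz => by
    rw [mem_ball_zero_iff] at hz
    rw [mem_ball_iff_norm, add_sub_cancel_left, norm_smul, Real.norm_of_nonneg hr.le]
    nlinarith
  have hs1 : (1 : WithTop ℕ∞) ≤ (s : WithTop ℕ∞) := by exact_mod_cast hs
  let w : E n → E n := fun z => r⁻¹ • u (p + r • z)
  have hTd : ∀ z, HasFDerivAt (fun z : E n => p + r • z) (r • ContinuousLinearMap.id ℝ (E n)) z :=
    fun z => ((hasFDerivAt_id z).const_smul r).const_add p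
  have hwd : ∀ z ∈ Metric.ball (0 : E n) 2, fderiv ℝ w z = fderiv ℝ u (p + r • z) := by
    intro z hz
    have h1 : HasFDerivAt u (fderiv ℝ u (p + r • z)) (p + r • z) :=
      (((hu _ (hmaps z hz)).1.of_le hs1).differentiableAt (by simp)).hasFDerivAt
    have h2 := (HasFDerivAt.comp (f := fun z : E n => p + r • z) z h1 (hTd z)).const_smul r⁻¹
    refine HasFDerivAt.fderiv (h2.congr_fderiv ?_)
    ext1 x
    simp [smul_smul, hr.ne']
  have hw : ∀ z ∈ Metric.ball (0 : E n) 2, IsHolderClassAt s β w z := fun z hz =>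
    (IsHolderClassAt.of_contDiffAt (f := fun _ => r⁻¹) hβ contDiffAt_const).clm₂ hβ
      (ContinuousLinearMap.lsmul ℝ ℝ)
      (IsHolderClassAt.comp (f := fun z : E n => p + r • z) hβ (hu _ (hmaps z hz)) (by fun_prop))
  have hw1 : ∀ z ∈ Metric.ball (0 : E n) 2, ContDiffAt ℝ 1 w z := fun z hz =>
    (hw z hz).1.of_le hs1
  have hw0 : w 0 = 0 := by simp [w, hp]
  have hwdiv : ∀ z ∈ Metric.ball (0 : E n) 2, euclDiv w z = 0 := fun z hz => by
    rw [euclDiv, hwd z hz]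
    exact hd _ (hmaps z hz)
  have hb := hKb w δ hw1 hw0 fun z hz => by
    rw [hwd z hz]
    exact hδ _ (hmaps z hz)
  have hF := isHolderClassAt_localize hβ hw
  let G : E n → E n := fun y => r • localize w (r⁻¹ • (y - p))
  have hGd : ∀ y, fderiv ℝ G y = fderiv ℝ (localize w) (r⁻¹ • (y - p)) := fun y => by
    have h1 : HasFDerivAt (localize w) (fderiv ℝ (localize w) (r⁻¹ • (y - p))) (r⁻¹ • (y - p)) :=
      (((hF _).1.of_le hs1).differentiableAt (by simp)).hasFDerivAt
    have h0 : HasFDerivAt (fun y : E n => r⁻¹ • (y - p))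
        (r⁻¹ • ContinuousLinearMap.id ℝ (E n)) y :=
      ((hasFDerivAt_id y).sub_const p).const_smul r⁻¹
    have h2 := (HasFDerivAt.comp (f := fun y : E n => r⁻¹ • (y - p)) y h1 h0).const_smul r
    refine HasFDerivAt.fderiv (h2.congr_fderiv ?_)
    ext1 x
    simp [smul_smul, hr.ne']
  refine ⟨G, fun y => ?_, fun y => ?_, ?_, fun y hy => ?_, fun y => ⟨?_, ?_⟩⟩
  · exact (IsHolderClassAt.of_contDiffAt (f := fun _ => r) hβ contDiffAt_const).clm₂ hβ
      (ContinuousLinearMap.lsmul ℝ ℝ)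
      (IsHolderClassAt.comp (f := fun y : E n => r⁻¹ • (y - p)) hβ (hF _) (by fun_prop))
  · rw [euclDiv, hGd]
    exact euclDiv_localize hn hw1 hwdiv _
  · have h0 : Tendsto (fun y : E n => r⁻¹ • (y - p)) (𝓝 p) (𝓝 0) := by
      have : Continuous fun y : E n => r⁻¹ • (y - p) := by fun_prop
      simpa using this.tendsto p
    filter_upwards [h0.eventually (localize_eventuallyEq w)] with y hy
    simp [G, hy, w, smul_smul, hr.ne']
  · have : 1 ≤ ‖r⁻¹ • (y - p)‖ := by
      rw [mem_closedBall_iff_norm, not_le] at hy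
      rw [norm_smul, Real.norm_of_nonneg (inv_nonneg.2 hr.le), ← div_eq_inv_mul, one_le_div hr]
      exact hy.le
    simp [G, localize_of_ge this]
  · rw [norm_smul, Real.norm_of_nonneg hr.le]
    exact mul_le_mul_of_nonneg_left (hb _).1 hr.le
  · rw [hGd]
    exact (hb _).2

end Cutoff

/-! ### Push-forward of fields by volume-preserving maps. -/

section Transport

variable {n : ℕ}

theorem differentiable_clm_det : Differentiable ℝ fun A : E n →L[ℝ] E n => A.det := by
  let b := (EuclideanSpace.basisFun (Fin n) ℝ).toBasis
  have h : (fun A : E n →L[ℝ] E n => A.det) = fun A : E n →L[ℝ] E n =>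
      ∑ σ : Equiv.Perm (Fin n), ((Equiv.Perm.sign σ : ℤ) : ℝ) *
        ∏ i, (A (EuclideanSpace.single i 1)) (σ i) := by
    funext A
    rw [ContinuousLinearMap.det, ← LinearMap.det_toMatrix b, Matrix.det_apply']
    simp [LinearMap.toMatrix_apply, b]
  rw [h]
  fun_prop

/-- Jacobi's formula at the identity, read off along each line `id + tA` from the derivative at `0`
of the polynomial `det(1 + X A)`. -/
theorem hasFDerivAt_clm_det_id :
    HasFDerivAt (fun A : E n →L[ℝ] E n => A.det) (traceCLM n) (ContinuousLinearMap.id ℝ (E n)) := by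
  let b := (EuclideanSpace.basisFun (Fin n) ℝ).toBasis
  have h := (differentiable_clm_det (ContinuousLinearMap.id ℝ (E n))).hasFDerivAt
  refine h.congr_fderiv ?_
  ext A
  have h1 : HasDerivAt (fun t : ℝ => ContinuousLinearMap.id ℝ (E n) + t • A) A 0 := by
    simpa using ((hasDerivAt_id (0 : ℝ)).smul_const A).const_add (ContinuousLinearMap.id ℝ (E n))
  have h0 : HasFDerivAt (fun A : E n →L[ℝ] E n => A.det)
      (fderiv ℝ (fun A : E n →L[ℝ] E n => A.det) (ContinuousLinearMap.id ℝ (E n)))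
      (ContinuousLinearMap.id ℝ (E n) + (0 : ℝ) • A) := by
    rw [zero_smul ℝ A, add_zero]
    exact h
  have h2 := HasFDerivAt.comp_hasDerivAt (f := fun t : ℝ => ContinuousLinearMap.id ℝ (E n) + t • A)
    (0 : ℝ) h0 h1
  have h3 : HasDerivAt (fun t : ℝ => (ContinuousLinearMap.id ℝ (E n) + t • A).det)
      (traceCLM n A) 0 := by
    have hM : ∀ t : ℝ, (ContinuousLinearMap.id ℝ (E n) + t • A).det =
        (1 + (Polynomial.X : Polynomial ℝ) •
          (LinearMap.toMatrix b b A.toLinearMap).map Polynomial.C).det.eval t := fun t => by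
      rw [ContinuousLinearMap.det, ← LinearMap.det_toMatrix b, ← Polynomial.coe_evalRingHom,
        RingHom.map_det]
      congr 1
      ext i j
      simp [Matrix.one_apply, LinearMap.toMatrix_apply, b, apply_ite]
      exact mul_comm _ _
    have h4 := (1 + (Polynomial.X : Polynomial ℝ) •
          (LinearMap.toMatrix b b A.toLinearMap).map Polynomial.C).det.hasDerivAt (0 : ℝ)
    rw [Matrix.derivative_det_one_add_X_smul, ← LinearMap.trace_eq_matrix_trace] at h4
    rw [funext hM]
    exact h4
  exact h2.unique h3

/-- Infinitesimal form of the conservation of volume. -/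
theorem trace_fderiv_fderiv_of_det_eq_one {T : E n → E n} {x : E n} (hT : ContDiffAt ℝ 2 T x)
    (hdet : ∀ᶠ z in 𝓝 x, (fderiv ℝ T z).det = 1) {N : E n →L[ℝ] E n}
    (hN : N.comp (fderiv ℝ T x) = ContinuousLinearMap.id ℝ (E n)) (u : E n) :
    traceCLM n (N.comp (fderiv ℝ (fderiv ℝ T) x u)) = 0 := by
  have hd : HasFDerivAt (fderiv ℝ T) (fderiv ℝ (fderiv ℝ T) x) x :=
    ((hT.fderiv_right (m := 1) (by norm_num)).differentiableAt (by simp)).hasFDerivAt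
  have h1 : HasFDerivAt (fun z => N.comp (fderiv ℝ T z))
      ((ContinuousLinearMap.compL ℝ (E n) (E n) (E n) N).comp (fderiv ℝ (fderiv ℝ T) x)) x :=
    (ContinuousLinearMap.compL ℝ (E n) (E n) (E n) N).hasFDerivAt.comp x hd
  have h2 := HasFDerivAt.comp (f := fun z => N.comp (fderiv ℝ T z)) x
    (by rw [hN]; exact hasFDerivAt_clm_det_id) h1
  -- The determinant of `N ∘ DT(z)` is constant near `x`; since `N ∘ DT(x) = id`, its derivative at
  -- `x` is the trace in question.
  have h3 : (fun A : E n →L[ℝ] E n => A.det) ∘ (fun z => N.comp (fderiv ℝ T z)) =ᶠ[𝓝 x]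
      fun _ => N.det := by
    filter_upwards [hdet] with z hz
    have : (N.comp (fderiv ℝ T z)).det = N.det * (fderiv ℝ T z).det := by
      simp [ContinuousLinearMap.det]
    simp [this, hz]
  have h4 := h2.unique ((hasFDerivAt_const N.det x).congr_of_eventuallyEq h3)
  simpa using DFunLike.congr_fun h4 u

/-- The push-forward of a vector field `F` on `ℝⁿ` by `T`, where `S` is the inverse of `T`. -/
def pushField (T S : E n → E n) (F : E n → E n) (y : E n) : E n :=
  fderiv ℝ T (S y) (F (S y))

theorem hasFDerivAt_pushField {T S F : E n → E n} {y : E n} (hT : ContDiffAt ℝ 2 T (S y))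
    (hS : DifferentiableAt ℝ S y) (hF : DifferentiableAt ℝ F (S y)) :
    HasFDerivAt (pushField T S F)
      ((fderiv ℝ T (S y)).comp ((fderiv ℝ F (S y)).comp (fderiv ℝ S y)) +
        ((fderiv ℝ (fderiv ℝ T) (S y)).comp (fderiv ℝ S y)).flip (F (S y))) y := by
  have hd : HasFDerivAt (fderiv ℝ T) (fderiv ℝ (fderiv ℝ T) (S y)) (S y) :=
    ((hT.fderiv_right (m := 1) (by norm_num)).differentiableAt (by simp)).hasFDerivAt
  exact (hd.comp y hS.hasFDerivAt).clm_apply (hF.hasFDerivAt.comp y hS.hasFDerivAt)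

/-- The derivative of the push-forward is `DT ∘ DF ∘ DS` plus a term in `D²T`. The first has trace
`div F` by cyclicity. By symmetry of `D²T` the second is `D²T(F) ∘ DS`, whose trace vanishes because
`det DT = 1`. -/
theorem euclDiv_pushField {T S F : E n → E n} {y : E n} (hT : ContDiffAt ℝ 2 T (S y))
    (hS : DifferentiableAt ℝ S y) (hF : DifferentiableAt ℝ F (S y))
    (hdet : ∀ᶠ z in 𝓝 (S y), (fderiv ℝ T z).det = 1)
    (hN : (fderiv ℝ S y).comp (fderiv ℝ T (S y)) = ContinuousLinearMap.id ℝ (E n)) :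
    euclDiv (pushField T S F) y = euclDiv F (S y) := by
  have hcomm : ∀ A B : E n →L[ℝ] E n, traceCLM n (A.comp B) = traceCLM n (B.comp A) :=
    fun A B => LinearMap.trace_comp_comm' B.toLinearMap A.toLinearMap
  have hsymm := hT.isSymmSndFDerivAt (by simp)
  have h2 : ((fderiv ℝ (fderiv ℝ T) (S y)).comp (fderiv ℝ S y)).flip (F (S y)) =
      (fderiv ℝ (fderiv ℝ T) (S y) (F (S y))).comp (fderiv ℝ S y) := by
    ext1 h
    exact hsymm _ _
  rw [euclDiv, (hasFDerivAt_pushField hT hS hF).fderiv, ← traceCLM_apply, map_add, h2, hcomm,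
    ContinuousLinearMap.comp_assoc, hN, ContinuousLinearMap.comp_id, hcomm,
    trace_fderiv_fderiv_of_det_eq_one hT hdet hN, add_zero]
  rfl

theorem norm_pushField_le {T S F : E n → E n} {y : E n} {B a : ℝ}
    (hT : ‖fderiv ℝ T (S y)‖ ≤ B) (hF : ‖F (S y)‖ ≤ a) : ‖pushField T S F y‖ ≤ B * a :=
  (fderiv ℝ T (S y)).le_of_opNorm_le_of_le hT hF

/-- One `B ^ 2 * a` comes from `DT ∘ DF ∘ DS`, the other from the term in `D²T`. -/
theorem norm_fderiv_pushField_le {T S F : E n → E n} {y : E n} {B a : ℝ}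
    (hT : ContDiffAt ℝ 2 T (S y)) (hS : DifferentiableAt ℝ S y)
    (hF : DifferentiableAt ℝ F (S y)) (hT1 : ‖fderiv ℝ T (S y)‖ ≤ B)
    (hT2 : ‖fderiv ℝ (fderiv ℝ T) (S y)‖ ≤ B) (hS1 : ‖fderiv ℝ S y‖ ≤ B)
    (hF0 : ‖F (S y)‖ ≤ a) (hF1 : ‖fderiv ℝ F (S y)‖ ≤ a) :
    ‖fderiv ℝ (pushField T S F) y‖ ≤ 2 * B ^ 2 * a := by
  have ha : 0 ≤ a := (norm_nonneg _).trans hF0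
  rw [(hasFDerivAt_pushField hT hS hF).fderiv]
  refine ContinuousLinearMap.opNorm_le_bound _ (by positivity) fun h => ?_
  have e0 : ‖fderiv ℝ S y h‖ ≤ B * ‖h‖ := (fderiv ℝ S y).le_of_opNorm_le hS1 h
  have e1 : ‖fderiv ℝ T (S y) (fderiv ℝ F (S y) (fderiv ℝ S y h))‖ ≤ B * (a * (B * ‖h‖)) :=
    ContinuousLinearMap.le_of_opNorm_le_of_le _ hT1
      (ContinuousLinearMap.le_of_opNorm_le_of_le _ hF1 e0)
  have e2 : ‖fderiv ℝ (fderiv ℝ T) (S y) (fderiv ℝ S y h) (F (S y))‖ ≤ B * (B * ‖h‖) * a :=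
    ContinuousLinearMap.le_of_opNorm_le_of_le _
      (ContinuousLinearMap.le_of_opNorm_le_of_le _ hT2 e0) hF0
  calc _ ≤ _ := norm_add_le _ _
    _ ≤ B * (a * (B * ‖h‖)) + B * (B * ‖h‖) * a := add_le_add e1 e2
    _ = _ := by ring

theorem isHolderClassAt_pushField {T S F : E n → E n} {y : E n} {s : ℕ∞} {β : ℝ≥0} (hβ : β ≤ 1)
    (hT : ContDiffAt ℝ ∞ T (S y)) (hS : ContDiffAt ℝ ∞ S y)
    (hF : IsHolderClassAt s β F (S y)) : IsHolderClassAt s β (pushField T S F) y := by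
  have h1 : ContDiffAt ℝ ∞ (fun z => fderiv ℝ T (S z)) y :=
    (hT.fderiv_right (m := ∞) (by simp)).comp y hS
  exact (IsHolderClassAt.of_contDiffAt hβ h1).clm_apply hβ (hF.comp hβ hS)

end Transport

/-! ### Changes of charts, and fields on the manifold supported in one chart. -/

section Charts

variable {n : ℕ} {M : Type*} [TopologicalSpace M] [ChartedSpace (E n) M]
  {e e' : OpenPartialHomeomorph M (E n)}

theorem contDiffAt_transition (he : e ∈ IsManifold.maximalAtlas (𝓡 n) ∞ M)
    (he' : e' ∈ IsManifold.maximalAtlas (𝓡 n) ∞ M) {z : E n} (hz : z ∈ e.target)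
    (hz' : e.symm z ∈ e'.source) : ContDiffAt ℝ ∞ (e' ∘ e.symm) z :=
  contMDiffAt_iff_contDiffAt.1 ((contMDiffAt_of_mem_maximalAtlas he' hz').comp z
    (contMDiffAt_symm_of_mem_maximalAtlas he hz))

theorem fderiv_transition_comp (he : e ∈ IsManifold.maximalAtlas (𝓡 n) ∞ M)
    (he' : e' ∈ IsManifold.maximalAtlas (𝓡 n) ∞ M) {y : E n} (hy : y ∈ e'.target)
    (hy' : e'.symm y ∈ e.source) :
    (fderiv ℝ (e ∘ e'.symm) y).comp (fderiv ℝ (e' ∘ e.symm) ((e ∘ e'.symm) y)) =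
      ContinuousLinearMap.id ℝ (E n) := by
  set x := (e ∘ e'.symm) y with hx
  have hxt : x ∈ e.target := e.map_source hy'
  have hxs : e.symm x = e'.symm y := e.left_inv hy'
  have hTx : (e' ∘ e.symm) x = y := by simp [hxs, hy]
  have hT : DifferentiableAt ℝ (e' ∘ e.symm) x :=
    (contDiffAt_transition he he' hxt (hxs ▸ e'.map_target hy)).differentiableAt (by simp)
  have hS : DifferentiableAt ℝ (e ∘ e'.symm) ((e' ∘ e.symm) x) := by
    rw [hTx]
    exact (contDiffAt_transition he' he hy hy').differentiableAt (by simp)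
  have h := fderiv_comp x hS hT
  rw [hTx] at h
  rw [← h, ← fderiv_id (𝕜 := ℝ) (x := x)]
  refine Filter.EventuallyEq.fderiv_eq ?_
  have hev : ∀ᶠ z in 𝓝 x, e.symm z ∈ e'.source :=
    (e.continuousAt_symm hxt).eventually
      (e'.open_source.mem_nhds (hxs ▸ e'.map_target hy))
  filter_upwards [hev, e.open_target.mem_nhds hxt] with z h1 h2
  simp [e'.left_inv h1, e.right_inv h2]

/-- The volume form is evaluated at one point on the image of the standard basis through both
charts: one side gives `1`, the other `det DT`. -/
theorem det_fderiv_transition {vol : VolumeForm n M}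
    (he : e ∈ IsManifold.maximalAtlas (𝓡 n) ∞ M) (he' : e' ∈ IsManifold.maximalAtlas (𝓡 n) ∞ M)
    (hv : ∀ y ∈ e.target, formInChart vol.form e y = canonicalForm n)
    (hv' : ∀ y ∈ e'.target, formInChart vol.form e' y = canonicalForm n) {z : E n}
    (hz : z ∈ e.target) (hz' : e.symm z ∈ e'.source) :
    (fderiv ℝ (e' ∘ e.symm) z).det = 1 := by
  set T := e' ∘ e.symm with hT
  let b := (EuclideanSpace.basisFun (Fin n) ℝ).toBasis
  -- Tangent spaces at all points unfold to `E n`; with these fixed types the base point can be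
  -- rewritten.
  let V : M → ((E n) [⋀^Fin n]→ₗ[ℝ] ℝ) := vol.form
  let D : E n → (E n →L[ℝ] E n) := fun x => mfderiv (𝓡 n) (𝓡 n) e'.symm x
  let D₀ : E n →L[ℝ] E n := mfderiv (𝓡 n) (𝓡 n) e.symm z
  have hTz : T z ∈ e'.target := e'.map_source hz'
  have hsym : e'.symm (T z) = e.symm z := e'.left_inv hz'
  have hD : D₀ = (D (T z)).comp (fderiv ℝ T z) := by
    have h1 : e.symm =ᶠ[𝓝 z] e'.symm ∘ T := by
      filter_upwards [(e.continuousAt_symm hz).eventually (e'.open_source.mem_nhds hz')] with x hx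
      exact (e'.left_inv hx).symm
    have h2 : mfderiv (𝓡 n) (𝓡 n) e.symm z = mfderiv (𝓡 n) (𝓡 n) (e'.symm ∘ T) z :=
      h1.mfderiv_eq
    have h3 := mfderiv_comp (I := 𝓡 n) (I' := 𝓡 n) (I'' := 𝓡 n) z
      ((contMDiffAt_symm_of_mem_maximalAtlas he' hTz).mdifferentiableAt (by simp))
      ((contDiffAt_transition he he' hz hz').contMDiffAt.mdifferentiableAt (by simp))
    rw [mfderiv_eq_fderiv] at h3
    exact h2.trans h3
  have h1 : V (e.symm z) (fun i => D₀ (b i)) = 1 := by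
    have := congrArg (fun f => f b) (hv z hz)
    simp only [canonicalForm] at this
    rw [Module.Basis.det_self] at this
    exact this
  have h2 : V (e'.symm (T z)) (fun i => D (T z) (fderiv ℝ T z (b i))) =
      (fderiv ℝ T z).det := by
    have := congrArg (fun f => f (fun i => fderiv ℝ T z (b i))) (hv' (T z) hTz)
    refine this.trans ?_
    have h3 := Module.Basis.det_comp b (fderiv ℝ T z).toLinearMap b
    rw [Module.Basis.det_self, mul_one] at h3
    exact h3
  rw [← h2, hsym, ← h1, hD]
  rfl

/-- The vector field on `M` supported in the source of `e` whose expression in `e` is `F`. -/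
def pullField (e : OpenPartialHomeomorph M (E n)) (F : E n → E n) (p : M) :
    TangentSpace (𝓡 n) p :=
  (e.source.indicator (fun q => (mfderiv (𝓡 n) (𝓡 n) e.symm (e q) (F (e q)) : E n)) p : E n)

theorem pullField_of_mem (F : E n → E n) {p : M} (hp : p ∈ e.source) :
    (pullField e F p : E n) = mfderiv (𝓡 n) (𝓡 n) e.symm (e p) (F (e p)) :=
  indicator_of_mem hp _

theorem pullField_of_notMem (F : E n → E n) {p : M} (hp : p ∉ e.source) :
    pullField e F p = 0 :=
  indicator_of_notMem hp _

theorem chartExpr_pullField (he : e ∈ IsManifold.maximalAtlas (𝓡 n) ∞ M)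
    (he' : e' ∈ IsManifold.maximalAtlas (𝓡 n) ∞ M) (F : E n → E n) {y : E n}
    (hy : y ∈ e'.target) (hy' : e'.symm y ∈ e.source) :
    chartExpr e' (pullField e F) y = pushField (e' ∘ e.symm) (e ∘ e'.symm) F y := by
  have hxt : e (e'.symm y) ∈ e.target := e.map_source hy'
  have hxs : e.symm (e (e'.symm y)) = e'.symm y := e.left_inv hy'
  let D : M → (E n →L[ℝ] E n) := fun q => mfderiv (𝓡 n) (𝓡 n) e' q
  have hxe : e.symm (e (e'.symm y)) ∈ e'.source := by
    rw [hxs]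
    exact e'.map_target hy
  have h1 : mfderiv (𝓡 n) (𝓡 n) (e' ∘ e.symm) (e (e'.symm y)) = _ :=
    mfderiv_comp (I := 𝓡 n) (I' := 𝓡 n) (I'' := 𝓡 n) (e (e'.symm y))
      ((contMDiffAt_of_mem_maximalAtlas he' hxe).mdifferentiableAt (by simp))
      ((contMDiffAt_symm_of_mem_maximalAtlas he hxt).mdifferentiableAt (by simp))
  rw [mfderiv_eq_fderiv] at h1
  rw [pushField, Function.comp_apply (f := e), h1]
  change D (e'.symm y) (pullField e F (e'.symm y)) = D (e.symm (e (e'.symm y))) _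
  rw [hxs]
  exact congrArg (D (e'.symm y)) (pullField_of_mem F hy')

theorem chartExpr_pullField_self (he : e ∈ IsManifold.maximalAtlas (𝓡 n) ∞ M) (F : E n → E n)
    {y : E n} (hy : y ∈ e.target) : chartExpr e (pullField e F) y = F y := by
  have hs := e.map_target hy
  rw [chartExpr_pullField he he F hy hs, pushField]
  have h : e ∘ e.symm =ᶠ[𝓝 y] id := e.eventually_right_inverse hy
  have hy1 : (e ∘ e.symm) y = y := e.right_inv hy
  rw [hy1, h.fderiv_eq, fderiv_id]
  rfl

theorem chartExpr_congr {X Y : ∀ p : M, TangentSpace (𝓡 n) p} {y : E n} (hy : y ∈ e.target)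
    (h : ∀ᶠ p in 𝓝 (e.symm y), X p = Y p) : chartExpr e X =ᶠ[𝓝 y] chartExpr e Y := by
  filter_upwards [(e.continuousAt_symm hy).eventually h] with z hz
  rw [chartExpr, chartExpr, hz]

theorem chartExpr_add (X Y : ∀ p : M, TangentSpace (𝓡 n) p) (y : E n) :
    chartExpr e (fun p => X p + Y p) y = chartExpr e X y + chartExpr e Y y :=
  map_add (mfderiv (𝓡 n) (𝓡 n) e (e.symm y)) (X (e.symm y)) (Y (e.symm y))

theorem chartExpr_zero (y : E n) :
    chartExpr e (fun p : M => (0 : TangentSpace (𝓡 n) p)) y = 0 :=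
  map_zero (mfderiv (𝓡 n) (𝓡 n) e (e.symm y))

theorem divInChart_eq_euclDiv {vol : VolumeForm n M}
    (hv : ∀ y ∈ e.target, formInChart vol.form e y = canonicalForm n)
    (X : ∀ p : M, TangentSpace (𝓡 n) p) {y : E n} (hy : y ∈ e.target) :
    divInChart vol e X y = euclDiv (chartExpr e X) y := by
  have h1 : ∀ z ∈ e.target, formDensity vol.form e z = 1 := fun z hz => by
    rw [formDensity, hv z hz, canonicalForm, ← OrthonormalBasis.coe_toBasis]
    exact Module.Basis.det_self _
  have h2 : (fun z => formDensity vol.form e z • chartExpr e X z) =ᶠ[𝓝 y] chartExpr e X := by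
    filter_upwards [e.open_target.mem_nhds hy] with z hz
    rw [h1 z hz, one_smul]
  rw [divInChart, h1 y hy, h2.fderiv_eq, inv_one, one_mul, euclDiv]

/-- A field whose expression in the chart `e` is supported in a compact subset of the target of
`e` vanishes off a compact subset of `M`. -/
theorem pullField_eq_zero {F : E n → E n} {K : Set (E n)} (hF : ∀ y ∉ K, F y = 0) {p : M}
    (hp : p ∉ e.symm '' K) : pullField e F p = 0 := by
  by_cases h : p ∈ e.source
  · have h1 : e p ∉ K := fun h1 => hp ⟨e p, h1, e.left_inv h⟩
    have h2 := pullField_of_mem F h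
    rw [hF _ h1] at h2
    exact h2.trans (map_zero (mfderiv (𝓡 n) (𝓡 n) e.symm (e p)))
  · exact pullField_of_notMem F h

theorem isClosed_symm_image {M : Type*} [TopologicalSpace M] [T2Space M]
    {e : OpenPartialHomeomorph M (E n)} {K : Set (E n)} (hK : IsCompact K) (hKe : K ⊆ e.target) :
    IsClosed (e.symm '' K) :=
  (hK.image_of_continuousOn (e.continuousOn_symm.mono hKe)).isClosed

theorem symm_image_subset_source {M : Type*} [TopologicalSpace M]
    {e : OpenPartialHomeomorph M (E n)} {K : Set (E n)} (hKe : K ⊆ e.target) :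
    e.symm '' K ⊆ e.source := by
  rintro _ ⟨y, hy, rfl⟩
  exact e.map_target (hKe hy)

theorem chartExpr_pullField_eventuallyEq (he : e ∈ IsManifold.maximalAtlas (𝓡 n) ∞ M)
    (he' : e' ∈ IsManifold.maximalAtlas (𝓡 n) ∞ M) (F : E n → E n) {y : E n}
    (hy : y ∈ e'.target) (hy' : e'.symm y ∈ e.source) :
    chartExpr e' (pullField e F) =ᶠ[𝓝 y] pushField (e' ∘ e.symm) (e ∘ e'.symm) F := by
  filter_upwards [e'.open_target.mem_nhds hy,
    (e'.continuousAt_symm hy).eventually (e.open_source.mem_nhds hy')] with z h1 h2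
  exact chartExpr_pullField he he' F h1 h2

variable [T2Space M]

/-- The support is compact, hence closed in the Hausdorff space `M`, so a point outside the source
of `e` has a whole neighbourhood where the field vanishes. This makes extension by zero smooth
across the boundary of the chart domain. -/
theorem chartExpr_pullField_eventuallyEq_zero {F : E n → E n} {K : Set (E n)}
    (hK : IsCompact K) (hKe : K ⊆ e.target) (hF : ∀ y ∉ K, F y = 0) {y : E n}
    (hy : y ∈ e'.target) (hy' : e'.symm y ∉ e.source) :
    chartExpr e' (pullField e F) =ᶠ[𝓝 y] fun _ => 0 := by
  have h : ∀ᶠ p in 𝓝 (e'.symm y), pullField e F p = 0 := by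
    filter_upwards [(isClosed_symm_image hK hKe).isOpen_compl.mem_nhds
      fun h => hy' (symm_image_subset_source hKe h)] with p hp
    exact pullField_eq_zero hF hp
  filter_upwards [chartExpr_congr hy h] with z hz
  rw [hz, chartExpr_zero]

theorem isHolderClassAt_chartExpr_pullField (he : e ∈ IsManifold.maximalAtlas (𝓡 n) ∞ M)
    (he' : e' ∈ IsManifold.maximalAtlas (𝓡 n) ∞ M) {s : ℕ∞} {β : ℝ≥0} (hβ : β ≤ 1)
    {F : E n → E n} {K : Set (E n)}
    (hK : IsCompact K) (hKe : K ⊆ e.target) (hF : ∀ y ∉ K, F y = 0)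
    (hFs : ∀ y, IsHolderClassAt s β F y) {y : E n} (hy : y ∈ e'.target) :
    IsHolderClassAt s β (chartExpr e' (pullField e F)) y := by
  by_cases hy' : e'.symm y ∈ e.source
  · refine (isHolderClassAt_pushField hβ (contDiffAt_transition he he' (e.map_source hy') ?_)
      (contDiffAt_transition he' he hy hy') (hFs _)).congr
      (chartExpr_pullField_eventuallyEq he he' F hy hy')
    rw [Function.comp_apply, e.left_inv hy']
    exact e'.map_target hy
  · exact (IsHolderClassAt.of_contDiffAt hβ contDiffAt_const).congr
      (chartExpr_pullField_eventuallyEq_zero hK hKe hF hy hy')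

theorem euclDiv_chartExpr_pullField {vol : VolumeForm n M}
    (he : e ∈ IsManifold.maximalAtlas (𝓡 n) ∞ M)
    (he' : e' ∈ IsManifold.maximalAtlas (𝓡 n) ∞ M)
    (hv : ∀ y ∈ e.target, formInChart vol.form e y = canonicalForm n)
    (hv' : ∀ y ∈ e'.target, formInChart vol.form e' y = canonicalForm n)
    {F : E n → E n} {K : Set (E n)}
    (hK : IsCompact K) (hKe : K ⊆ e.target) (hF : ∀ y ∉ K, F y = 0)
    (hFd : Differentiable ℝ F) (hdiv : ∀ y, euclDiv F y = 0) {y : E n} (hy : y ∈ e'.target) :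
    euclDiv (chartExpr e' (pullField e F)) y = 0 := by
  by_cases hy' : e'.symm y ∈ e.source
  · have hx : (e ∘ e'.symm) y ∈ e.target := e.map_source hy'
    have hx' : e.symm ((e ∘ e'.symm) y) ∈ e'.source := by
      rw [Function.comp_apply, e.left_inv hy']
      exact e'.map_target hy
    rw [euclDiv_congr (chartExpr_pullField_eventuallyEq he he' F hy hy'), euclDiv_pushField
      ((contDiffAt_transition he he' hx hx').of_le ENat.LEInfty.out)
      ((contDiffAt_transition he' he hy hy').differentiableAt (by simp)) (hFd _) ?_
      (fderiv_transition_comp he he' hy hy'), hdiv]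
    filter_upwards [e.open_target.mem_nhds hx,
      (e.continuousAt_symm hx).eventually (e'.open_source.mem_nhds hx')] with z h1 h2
    exact det_fderiv_transition he he' hv hv' h1 h2
  · rw [euclDiv_congr (chartExpr_pullField_eventuallyEq_zero hK hKe hF hy hy'), euclDiv]
    simp

/-- The hypothesis `1 ≤ B` lets the bound `B * a` of the field itself be absorbed in that of its
derivative. -/
theorem norm_chartExpr_pullField_le (he : e ∈ IsManifold.maximalAtlas (𝓡 n) ∞ M)
    (he' : e' ∈ IsManifold.maximalAtlas (𝓡 n) ∞ M) {F : E n → E n} {K : Set (E n)}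
    (hK : IsCompact K) (hKe : K ⊆ e.target) (hF : ∀ y ∉ K, F y = 0)
    (hFd : Differentiable ℝ F) {B a : ℝ} (hB : 1 ≤ B)
    (hT : ∀ x ∈ e.target, e.symm x ∈ e'.source → ‖fderiv ℝ (e' ∘ e.symm) x‖ ≤ B ∧
      ‖fderiv ℝ (fderiv ℝ (e' ∘ e.symm)) x‖ ≤ B)
    (hS : ∀ y ∈ e'.target, e'.symm y ∈ e.source → ‖fderiv ℝ (e ∘ e'.symm) y‖ ≤ B)
    (hFa : ∀ x, ‖F x‖ ≤ a ∧ ‖fderiv ℝ F x‖ ≤ a) {y : E n} (hy : y ∈ e'.target) :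
    ‖chartExpr e' (pullField e F) y‖ ≤ 2 * B ^ 2 * a ∧
      ‖fderiv ℝ (chartExpr e' (pullField e F)) y‖ ≤ 2 * B ^ 2 * a := by
  have ha : 0 ≤ a := (norm_nonneg _).trans (hFa 0).1
  by_cases hy' : e'.symm y ∈ e.source
  · have hx : (e ∘ e'.symm) y ∈ e.target := e.map_source hy'
    have hx' : e.symm ((e ∘ e'.symm) y) ∈ e'.source := by
      rw [Function.comp_apply, e.left_inv hy']
      exact e'.map_target hy
    have hev := chartExpr_pullField_eventuallyEq he he' F hy hy'
    rw [hev.fderiv_eq, hev.eq_of_nhds]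
    refine ⟨(norm_pushField_le (hT _ hx hx').1 (hFa _).1).trans ?_, norm_fderiv_pushField_le
      ((contDiffAt_transition he he' hx hx').of_le ENat.LEInfty.out)
      ((contDiffAt_transition he' he hy hy').differentiableAt (by simp)) (hFd _)
      (hT _ hx hx').1 (hT _ hx hx').2 (hS y hy hy') (hFa _).1 (hFa _).2⟩
    exact mul_le_mul_of_nonneg_right (by nlinarith) ha
  · have hev := chartExpr_pullField_eventuallyEq_zero hK hKe hF hy hy'
    rw [hev.fderiv_eq, hev.eq_of_nhds]
    have : 0 ≤ 2 * B ^ 2 * a := by positivity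
    simp [this]

end Charts

/-! ### Uniformity from regularity of the atlas, and the correction at one point. -/

section Atlas

variable {n m : ℕ} {M : Type*} [TopologicalSpace M] [ChartedSpace (E n) M]

theorem chartExpr_eqOn_of_extends {e Φ : OpenPartialHomeomorph M (E n)}
    (hs : e.source ⊆ Φ.source) (h : EqOn Φ e e.source) (X : ∀ p : M, TangentSpace (𝓡 n) p) :
    EqOn (chartExpr Φ X) (chartExpr e X) e.target := by
  intro y hy
  have hq := e.map_target hy
  have hsym : Φ.symm y = e.symm y := by
    have h1 : Φ (e.symm y) = y := (h hq).trans (e.right_inv hy)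
    rw [← Φ.left_inv (hs hq), h1]
  let D : M → E n := fun q => mfderiv (𝓡 n) (𝓡 n) Φ q (X q)
  have h2 : mfderiv (𝓡 n) (𝓡 n) Φ (e.symm y) = mfderiv (𝓡 n) (𝓡 n) e (e.symm y) :=
    Filter.EventuallyEq.mfderiv_eq (h.eventuallyEq_of_mem (e.open_source.mem_nhds hq))
  change D (Φ.symm y) = _
  rw [hsym]
  exact DFunLike.congr_fun h2 (X (e.symm y))

theorem transition_eventuallyEq_of_extends {M : Type*} [TopologicalSpace M]
    {e e' Φ Φ' : OpenPartialHomeomorph M (E n)}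
    (hs : e.source ⊆ Φ.source) (h : EqOn Φ e e.source) (h' : EqOn Φ' e' e'.source) {x : E n}
    (hx : x ∈ e.target) (hx' : e.symm x ∈ e'.source) :
    e' ∘ e.symm =ᶠ[𝓝 x] Φ' ∘ Φ.symm := by
  filter_upwards [e.open_target.mem_nhds hx,
    (e.continuousAt_symm hx).eventually (e'.open_source.mem_nhds hx')] with y hy hy'
  have hq := e.map_target hy
  have hsym : Φ.symm y = e.symm y := by
    have h1 : Φ (e.symm y) = y := (h hq).trans (e.right_inv hy)
    rw [← Φ.left_inv (hs hq), h1]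
  simp only [Function.comp_apply, hsym]
  exact (h' hy').symm

theorem IsHolderClassOn.congr {s : ℕ∞} {β : ℝ≥0} {f g : E n → E n} {Ω : Set (E n)}
    (hΩ : IsOpen Ω) (hf : IsHolderClassOn s β f Ω) (h : EqOn g f Ω) :
    IsHolderClassOn s β g Ω := by
  refine ⟨hf.1.congr h, fun h0 k hk => ?_⟩
  obtain ⟨C, hC⟩ := hf.2 h0 k hk
  refine ⟨C, fun y hy z hz => ?_⟩
  have key : ∀ y ∈ Ω, iteratedFDeriv ℝ k g y = iteratedFDeriv ℝ k f y := fun y hy =>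
    ((h.eventuallyEq_of_mem (hΩ.mem_nhds hy)).iteratedFDeriv ℝ k).eq_of_nhds
  rw [key y hy, key z hz]
  exact hC y hy z hz

/-- The first two derivatives of the changes of charts are bounded by `B`. -/
def FiniteAtlas.IsTransitionBound (𝒜 : FiniteAtlas n m M) (B : ℝ) : Prop :=
  ∀ i j, ∀ x ∈ (𝒜.chart i).target, (𝒜.chart i).symm x ∈ (𝒜.chart j).source →
    ‖fderiv ℝ (𝒜.chart j ∘ (𝒜.chart i).symm) x‖ ≤ B ∧
      ‖fderiv ℝ (fderiv ℝ (𝒜.chart j ∘ (𝒜.chart i).symm)) x‖ ≤ B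

/-- In a regular atlas on a compact manifold, the first two derivatives of the changes of charts
are bounded. -/
theorem FiniteAtlas.IsRegular.exists_transition_bound [CompactSpace M] {𝒜 : FiniteAtlas n m M}
    {vol : VolumeForm n M} (h : 𝒜.IsRegular vol) :
    ∃ B : ℝ, 1 ≤ B ∧ 𝒜.IsTransitionBound B := by
  obtain ⟨ℬ, -, hℬ⟩ := h
  have key : ∀ q : Fin m × Fin m, ∃ B : ℝ, ∀ x ∈ (𝒜.chart q.1).target,
      (𝒜.chart q.1).symm x ∈ (𝒜.chart q.2).source →
      ‖fderiv ℝ (𝒜.chart q.2 ∘ (𝒜.chart q.1).symm) x‖ ≤ B ∧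
        ‖fderiv ℝ (fderiv ℝ (𝒜.chart q.2 ∘ (𝒜.chart q.1).symm)) x‖ ≤ B := by
    rintro ⟨i, j⟩
    dsimp only
    set Φ := ℬ.chart i
    set Φ' := ℬ.chart j
    set T := Φ' ∘ Φ.symm with hT
    -- This set is compact and lies in both enlarged chart domains, so the enlarged change of charts
    -- is smooth at every point of its image and its derivatives are bounded there.
    set K₀ := closure (𝒜.chart i).source ∩ closure (𝒜.chart j).source
    have hK₀ : IsCompact K₀ := (isClosed_closure.inter isClosed_closure).isCompact
    have hK₀i : K₀ ⊆ Φ.source := inter_subset_left.trans (hℬ i).1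
    have hK₀j : K₀ ⊆ Φ'.source := inter_subset_right.trans (hℬ j).1
    have hK : IsCompact (Φ '' K₀) := hK₀.image_of_continuousOn (Φ.continuousOn.mono hK₀i)
    have hsmooth : ∀ x ∈ Φ '' K₀, ContDiffAt ℝ ∞ T x := by
      rintro _ ⟨q, hq, rfl⟩
      refine contDiffAt_transition (ℬ.mem_maximalAtlas i) (ℬ.mem_maximalAtlas j)
        (Φ.map_source (hK₀i hq)) ?_
      rw [Φ.left_inv (hK₀i hq)]
      exact hK₀j hq
    have hsmooth' : ∀ x ∈ Φ '' K₀, ContDiffAt ℝ ∞ (fderiv ℝ T) x := fun x hx =>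
      (hsmooth x hx).fderiv_right (by simp)
    obtain ⟨B₁, hB₁⟩ := hK.exists_bound_of_continuousOn (f := fderiv ℝ T) fun x hx =>
      (hsmooth' x hx).continuousAt.continuousWithinAt
    obtain ⟨B₂, hB₂⟩ := hK.exists_bound_of_continuousOn (f := fderiv ℝ (fderiv ℝ T)) fun x hx =>
      ((hsmooth' x hx).continuousAt_fderiv (by simp)).continuousWithinAt
    refine ⟨max B₁ B₂, fun x hx hx' => ?_⟩
    have hq := (𝒜.chart i).map_target hx
    have hxK : x ∈ Φ '' K₀ := ⟨(𝒜.chart i).symm x, ⟨subset_closure hq, subset_closure hx'⟩,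
      ((hℬ i).2 hq).trans ((𝒜.chart i).right_inv hx)⟩
    have hev : 𝒜.chart j ∘ (𝒜.chart i).symm =ᶠ[𝓝 x] T :=
      transition_eventuallyEq_of_extends (subset_closure.trans (hℬ i).1) (hℬ i).2 (hℬ j).2 hx hx'
    rw [hev.fderiv_eq, hev.fderiv.fderiv_eq]
    exact ⟨le_max_of_le_left (hB₁ x hxK), le_max_of_le_right (hB₂ x hxK)⟩
  choose B hB using key
  obtain ⟨B', hB'⟩ := (Set.finite_range B).bddAbove
  refine ⟨max 1 B', le_max_left _ _, fun i j x hx hx' => ?_⟩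
  have h1 : B (i, j) ≤ max 1 B' := le_max_of_le_right (hB' ⟨_, rfl⟩)
  exact ⟨(hB (i, j) x hx hx').1.trans h1, (hB (i, j) x hx hx').2.trans h1⟩

/-- In a regular atlas, a field which is locally of class `C^{s,β}` in every smooth chart is
uniformly so in the charts of the atlas. -/
theorem FiniteAtlas.IsRegular.isHolderClassOn [CompactSpace M] {𝒜 : FiniteAtlas n m M}
    {vol : VolumeForm n M} (h : 𝒜.IsRegular vol) {s : ℕ∞} {β : ℝ≥0}
    {X : ∀ p : M, TangentSpace (𝓡 n) p}
    (hX : ∀ e ∈ IsManifold.maximalAtlas (𝓡 n) ∞ M, ∀ y ∈ e.target,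
      IsHolderClassAt s β (chartExpr e X) y) (i : Fin m) :
    IsHolderClassOn s β (chartExpr (𝒜.chart i) X) (𝒜.chart i).target := by
  obtain ⟨ℬ, -, hℬ⟩ := h
  set e := 𝒜.chart i
  set Φ := ℬ.chart i
  have hsub : closure e.source ⊆ Φ.source := (hℬ i).1
  have hK : IsCompact (Φ '' closure e.source) :=
    isClosed_closure.isCompact.image_of_continuousOn (Φ.continuousOn.mono hsub)
  -- Local regularity in the enlarged chart becomes uniform on the compact image of the closed chart
  -- domain.
  refine IsHolderClassOn.congr e.open_target (isHolderClassOn_of_isCompact hK ?_ ?_)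
    (chartExpr_eqOn_of_extends (subset_closure.trans hsub) (hℬ i).2 X).symm
  · intro y hy
    exact ⟨e.symm y, subset_closure (e.map_target hy),
      ((hℬ i).2 (e.map_target hy)).trans (e.right_inv hy)⟩
  · rintro _ ⟨q, hq, rfl⟩
    exact hX Φ (ℬ.mem_maximalAtlas i) _ (Φ.map_source (hsub hq))

theorem FiniteAtlas.whitneyNorm_one_le {𝒜 : FiniteAtlas n m M} {X : ∀ p : M, TangentSpace (𝓡 n) p}
    {a : ℝ} (h : ∀ i, ∀ y ∈ (𝒜.chart i).target, ‖chartExpr (𝒜.chart i) X y‖ ≤ a ∧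
      ‖fderiv ℝ (chartExpr (𝒜.chart i) X) y‖ ≤ a) : 𝒜.whitneyNorm 1 X ≤ ENNReal.ofReal a := by
  refine iSup_le fun i => iSup_le fun k => iSup_le fun hk => iSup_le fun y => iSup_le fun hy => ?_
  rw [← ofReal_norm]
  refine ENNReal.ofReal_le_ofReal ?_
  interval_cases k
  · rw [norm_iteratedFDeriv_zero]
    exact (h i y hy).1
  · rw [norm_iteratedFDeriv_one]
    exact (h i y hy).2

theorem euclDiv_affine_sub {u : E n → E n} {y p a : E n} {A : E n →L[ℝ] E n}
    (hu : DifferentiableAt ℝ u y) (hA : LinearMap.trace ℝ (E n) A.toLinearMap = 0)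
    (hd : euclDiv u y = 0) : euclDiv (fun y => a + A (y - p) - u y) y = 0 := by
  have h : HasFDerivAt (fun y => a + A (y - p)) A y := by
    simpa using (A.hasFDerivAt.comp y ((hasFDerivAt_id y).sub_const p)).const_add a
  rw [euclDiv_sub h.differentiableAt hu, hd, euclDiv, h.fderiv, hA, sub_zero]

/-- A divergence-free field with small support near `x`, which near `x` is the difference between
a given affine field and `v`, and which is `C¹` small. -/
theorem exists_local_correction [T2Space M] {𝒜 : FiniteAtlas n m M} {vol : VolumeForm n M}
    (hc : 𝒜.IsConservative vol) {K B : ℝ} (hK : 0 < K) (hB : 1 ≤ B)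
    (hloc : IsLocalizationConstant n K) (hBb : 𝒜.IsTransitionBound B)
    {s : ℕ∞} {β : ℝ≥0} (hs : 1 ≤ s) (hβ : β ≤ 1) {v : ∀ p : M, TangentSpace (𝓡 n) p}
    (hv : v ∈ 𝒜.divFreeFields vol s β) {i : Fin m} {x : M} (hx : x ∈ (𝒜.chart i).source)
    {N : Set M} (hN : N ∈ 𝓝 x) {A : E n →L[ℝ] E n}
    (hA : LinearMap.trace ℝ (E n) A.toLinearMap = 0) {δ : ℝ}
    (hδ : ‖A - fderiv ℝ (chartExpr (𝒜.chart i) v) (𝒜.chart i x)‖ < δ) :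
    ∃ (Y : ∀ p : M, TangentSpace (𝓡 n) p) (C : Set M), IsClosed C ∧ C ⊆ N ∧
      (∀ p ∉ C, Y p = 0) ∧
      (∀ e ∈ IsManifold.maximalAtlas (𝓡 n) ∞ M, ∀ y ∈ e.target,
        IsHolderClassAt s β (chartExpr e Y) y) ∧
      (∀ j, ∀ y ∈ (𝒜.chart j).target, euclDiv (chartExpr (𝒜.chart j) Y) y = 0) ∧
      (chartExpr (𝒜.chart i) Y =ᶠ[𝓝 (𝒜.chart i x)] fun y =>
        chartExpr (𝒜.chart i) v (𝒜.chart i x) + A (y - 𝒜.chart i x) -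
          chartExpr (𝒜.chart i) v y) ∧
      ∀ j, ∀ y ∈ (𝒜.chart j).target, ‖chartExpr (𝒜.chart j) Y y‖ ≤ 2 * B ^ 2 * (K * δ) ∧
        ‖fderiv ℝ (chartExpr (𝒜.chart j) Y) y‖ ≤ 2 * B ^ 2 * (K * δ) := by
  set e := 𝒜.chart i with he
  set p := e x with hp
  set f := chartExpr e v with hf
  have hpt : p ∈ e.target := e.map_source hx
  have hatlas := 𝒜.mem_maximalAtlas
  have hfc : ∀ y ∈ e.target, IsHolderClassAt s β f y := fun y hy =>
    (hv i).1.isHolderClassAt e.open_target hy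
  have hs1 : (1 : WithTop ℕ∞) ≤ (s : WithTop ℕ∞) := by exact_mod_cast hs
  have hf1 : ∀ y ∈ e.target, ContDiffAt ℝ 1 f y := fun y hy => (hfc y hy).1.of_le hs1
  have hfd : ∀ y ∈ e.target, DifferentiableAt ℝ f y := fun y hy =>
    (hf1 y hy).differentiableAt (by simp)
  have hfdiv : ∀ y ∈ e.target, euclDiv f y = 0 := fun y hy => by
    rw [← divInChart_eq_euclDiv (hc.1 i) v hy]
    exact (hv i).2 y hy
  have hsymm : e.symm p = x := e.left_inv hx
  -- The strict inequality at `p` persists nearby because `Df` is continuous; this is where `1 ≤ s`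
  -- enters the smallness of the correction.
  have hnear : ∀ᶠ y in 𝓝 p, y ∈ e.target ∧ e.symm y ∈ N ∧ ‖A - fderiv ℝ f y‖ < δ := by
    refine (e.open_target.eventually_mem hpt).and (((e.continuousAt_symm hpt).eventually ?_).and ?_)
    · rw [hsymm]
      exact hN
    · exact (continuousAt_const.sub
        ((hf1 p hpt).continuousAt_fderiv (by simp))).norm.eventually_lt_const hδ
  obtain ⟨ρ, hρ, hball⟩ := Metric.eventually_nhds_iff_ball.1 hnear
  -- The bound `r ≤ 1` turns the estimate `r * (K * δ)` of the field into `K * δ`.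
  obtain ⟨r, hr, hr1, h2r⟩ : ∃ r : ℝ, 0 < r ∧ r ≤ 1 ∧ 2 * r ≤ ρ :=
    ⟨min 1 (ρ / 2), by positivity, min_le_left _ _, by linarith [min_le_right 1 (ρ / 2)]⟩
  have hsub : ∀ y ∈ Metric.ball p (2 * r), y ∈ e.target ∧ e.symm y ∈ N ∧
      ‖A - fderiv ℝ f y‖ < δ := fun y hy => hball y (Metric.ball_subset_ball h2r hy)
  have hcl : Metric.closedBall p r ⊆ Metric.ball p (2 * r) :=
    Metric.closedBall_subset_ball (by linarith)
  have haff : ∀ y, HasFDerivAt (fun y => f p + A (y - p)) A y := fun y => by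
    simpa using (A.hasFDerivAt.comp y ((hasFDerivAt_id y).sub_const p)).const_add (f p)
  let u : E n → E n := fun y => f p + A (y - p) - f y
  have hu : ∀ y ∈ e.target, IsHolderClassAt s β u y := fun y hy => by
    have h1 : IsHolderClassAt s β (fun y => f p + A (y - p)) y :=
      .of_contDiffAt hβ (by fun_prop)
    have h2 : IsHolderClassAt s β (fun y => (-1 : ℝ) • f y) y :=
      (IsHolderClassAt.of_contDiffAt (f := fun _ => (-1 : ℝ)) hβ contDiffAt_const).clm₂ hβ
        (ContinuousLinearMap.lsmul ℝ ℝ) (hfc y hy)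
    refine (h1.add h2).congr (Eventually.of_forall fun z => ?_)
    simp [u, sub_eq_add_neg]
  obtain ⟨G, hG1, hG2, hG3, hG4, hG5⟩ := hloc s β hs hβ u p r δ hr
    (fun y hy => hu y (hsub y hy).1) (by simp [u])
    (fun y hy => euclDiv_affine_sub (hfd y (hsub y hy).1) hA (hfdiv y (hsub y hy).1))
    (fun y hy => by
      rw [((haff y).fun_sub (hfd y (hsub y hy).1).hasFDerivAt).fderiv]
      exact (hsub y hy).2.2.le)
  have hGd : Differentiable ℝ G := fun y => ((hG1 y).1.of_le hs1).differentiableAt (by simp)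
  have hcpt := isCompact_closedBall p r
  have hcle : Metric.closedBall p r ⊆ e.target := fun y hy => (hsub y (hcl hy)).1
  have hδ0 : 0 ≤ δ := (norm_nonneg _).trans hδ.le
  refine ⟨pullField e G, e.symm '' Metric.closedBall p r, isClosed_symm_image hcpt hcle, ?_,
    fun q hq => pullField_eq_zero hG4 hq, fun e' he' y hy =>
      isHolderClassAt_chartExpr_pullField (hatlas i) he' hβ hcpt hcle hG4 hG1 hy,
    fun j y hy => euclDiv_chartExpr_pullField (hatlas i) (hatlas j) (hc.1 i) (hc.1 j) hcpt hcle
      hG4 hGd hG2 hy, ?_, fun j y hy => ?_⟩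
  · rintro _ ⟨y, hy, rfl⟩
    exact (hsub y (hcl hy)).2.1
  · filter_upwards [hG3, e.open_target.mem_nhds hpt] with y h1 h2
    rw [chartExpr_pullField_self (hatlas i) G h2, h1]
  · refine norm_chartExpr_pullField_le (hatlas i) (hatlas j) hcpt hcle hG4 hGd hB (hBb i j)
      (fun y hy hy' => (hBb j i y hy hy').1) (fun z => ⟨(hG5 z).1.trans ?_, (hG5 z).2⟩) hy
    exact mul_le_of_le_one_left (by positivity) hr1

/-- A finite sum of fields with pairwise disjoint supports is locally one of them or zero. -/
theorem sum_eventuallyEq_of_disjoint (S : Finset M) (Y : M → ∀ p : M, TangentSpace (𝓡 n) p)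
    (C N : M → Set M) (hC : ∀ x ∈ S, IsClosed (C x)) (hCN : ∀ x ∈ S, C x ⊆ N x)
    (hNo : ∀ x ∈ S, IsOpen (N x)) (hNd : (S : Set M).PairwiseDisjoint N)
    (hY : ∀ x ∈ S, ∀ p ∉ C x, Y x p = 0) (q : M) :
    (∀ᶠ p in 𝓝 q, ∑ x ∈ S, Y x p = 0) ∨
      ∃ x ∈ S, ∀ᶠ p in 𝓝 q, ∑ z ∈ S, Y z p = Y x p := by
  by_cases h : ∃ x ∈ S, q ∈ N x
  · obtain ⟨x, hx, hq⟩ := h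
    refine .inr ⟨x, hx, ?_⟩
    filter_upwards [(hNo x hx).mem_nhds hq] with p hp
    refine Finset.sum_eq_single_of_mem x hx fun z hz hzx => hY z hz p fun hpz => ?_
    exact disjoint_left.1 (hNd hz hx hzx) (hCN z hz hpz) hp
  -- Outside all the open sets `N x`, the point avoids the finitely many closed sets `C x`, and so
  -- does a neighbourhood of it.
  · push Not at h
    left
    have h1 : ∀ᶠ p in 𝓝 q, ∀ x ∈ S, p ∉ C x := (Finset.eventually_all S).2 fun x hx =>
      (hC x hx).isOpen_compl.mem_nhds fun hq => h x hx (hCN x hx hq)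
    filter_upwards [h1] with p hp
    exact Finset.sum_eq_zero fun x hx => hY x hx p (hp x hx)

end Atlas

end ConservativeFields

end

/-! ### Superposition of the local corrections. -/

theorem theorem6 {n m : ℕ} (hn : 2 ≤ n) {M : Type*} [TopologicalSpace M] [T2Space M]
    [SecondCountableTopology M] [CompactSpace M] [ConnectedSpace M]
    [ChartedSpace (E n) M] [IsManifold (𝓡 n) ∞ M] (𝒜 : FiniteAtlas n m M) :
    ∃ χ : ℝ, 0 < χ ∧
      ∀ vol : VolumeForm n M, 𝒜.IsConservative vol → 𝒜.IsRegular vol →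
      ∀ (ε : ℝ), 0 < ε →
      ∀ (s : ℕ∞) (β : ℝ≥0), 1 ≤ s → β ≤ 1 →
      ∀ v ∈ 𝒜.divFreeFields vol s β,
      ∀ (S : Finset M) (U : Set M), U ∈ 𝓝ˢ (S : Set M) →
      ∀ (c : M → Fin m), (∀ x ∈ S, x ∈ (𝒜.chart (c x)).source) →
      ∀ (A : M → (E n →L[ℝ] E n)),
        (∀ x ∈ S, LinearMap.trace ℝ (E n) (A x).toLinearMap = 0) →
        (∀ x ∈ S,
          ‖A x - fderiv ℝ (chartExpr (𝒜.chart (c x)) v) (𝒜.chart (c x) x)‖ < χ * ε) →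
      ∃ Z ∈ 𝒜.divFreeFields vol s β,
        (∀ x ∈ S, ∀ᶠ y in 𝓝 (𝒜.chart (c x) x),
          chartExpr (𝒜.chart (c x)) Z y =
            chartExpr (𝒜.chart (c x)) v (𝒜.chart (c x) x) + A x (y - 𝒜.chart (c x) x)) ∧
        (∀ p ∉ U, Z p = v p) ∧
        𝒜.whitneyNorm 1 (fun p => Z p - v p) < ENNReal.ofReal ε := by
  -- The constant must be chosen before the volume form. Any form for which the atlas is regular
  -- will do, as the resulting bound `B` concerns only the changes of charts of `𝒜`.
  by_cases hreg : ∃ vol₀ : VolumeForm n M, 𝒜.IsRegular vol₀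
  swap
  · exact ⟨1, one_pos, fun vol _ h => absurd ⟨vol, h⟩ hreg⟩
  obtain ⟨vol₀, h₀⟩ := hreg
  obtain ⟨B, hB, hBb⟩ := h₀.exists_transition_bound
  obtain ⟨K, hK, hloc⟩ := exists_isLocalizationConstant hn
  -- A correction costs a factor `2 * B ^ 2 * K`; the extra factor `2` leaves the bound `ε / 2`, so
  -- that the supremum over all points is still strictly below `ε`.
  refine ⟨(4 * B ^ 2 * K)⁻¹, by positivity, fun vol hcons hreg ε hε s β hs hβ v hv S U hU c hc A
    hA hAε => ?_⟩
  have hbound : 2 * B ^ 2 * (K * ((4 * B ^ 2 * K)⁻¹ * ε)) = ε / 2 := by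
    have : B ≠ 0 := by positivity
    field_simp
    norm_num
  obtain ⟨N, hN, hNd⟩ := S.finite_toSet.t2_separation
  have hNx : ∀ x ∈ S, N x ∩ U ∈ 𝓝 x := fun x hx =>
    inter_mem ((hN x).2.mem_nhds (hN x).1) (mem_nhdsSet_iff_forall.1 hU x hx)
  have key := fun (x : M) (hx : x ∈ S) => exists_local_correction hcons hK hB hloc hBb hs hβ hv
    (hc x hx) (hNx x hx) (hA x hx) (hAε x hx)
  choose! Y C hCc hCN hY0 hYs hYd hYv hYb using key
  simp only [hbound] at hYb
  have hlocal := sum_eventuallyEq_of_disjoint S Y C N hCc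
    (fun x hx => (hCN x hx).trans inter_subset_left) (fun x _ => (hN x).2) hNd hY0
  set W : ∀ p : M, TangentSpace (𝓡 n) p := fun p => ∑ x ∈ S, Y x p
  -- Regularity, zero divergence and the `C¹` bound are all local, so each is inherited from a
  -- single correction or from zero.
  have hcase : ∀ (e : OpenPartialHomeomorph M (E n)), ∀ y ∈ e.target,
      (chartExpr e W =ᶠ[𝓝 y] fun _ => 0) ∨
        ∃ x ∈ S, chartExpr e W =ᶠ[𝓝 y] chartExpr e (Y x) := by
    intro e y hy
    rcases hlocal (e.symm y) with h | ⟨x, hx, h⟩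
    · left
      filter_upwards [chartExpr_congr (X := W) (Y := fun _ => 0) hy h] with z hz
      rw [hz, chartExpr_zero]
    · exact .inr ⟨x, hx, chartExpr_congr hy h⟩
  have hWs : ∀ e ∈ IsManifold.maximalAtlas (𝓡 n) ∞ M, ∀ y ∈ e.target,
      IsHolderClassAt s β (chartExpr e W) y := fun e he y hy => by
    rcases hcase e y hy with h | ⟨x, hx, h⟩
    · exact (IsHolderClassAt.of_contDiffAt hβ contDiffAt_const).congr h
    · exact (hYs x hx e he y hy).congr h
  have hWd : ∀ j, ∀ y ∈ (𝒜.chart j).target, euclDiv (chartExpr (𝒜.chart j) W) y = 0 :=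
    fun j y hy => by
    rcases hcase _ y hy with h | ⟨x, hx, h⟩
    · rw [euclDiv_congr h, euclDiv]
      simp
    · rw [euclDiv_congr h, hYd x hx j y hy]
  have hWb : ∀ j, ∀ y ∈ (𝒜.chart j).target, ‖chartExpr (𝒜.chart j) W y‖ ≤ ε / 2 ∧
      ‖fderiv ℝ (chartExpr (𝒜.chart j) W) y‖ ≤ ε / 2 := fun j y hy => by
    rcases hcase _ y hy with h | ⟨x, hx, h⟩
    · rw [h.eq_of_nhds, h.fderiv_eq]
      simp [(half_pos hε).le]
    · rw [h.eq_of_nhds, h.fderiv_eq]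
      exact hYb x hx j y hy
  have hs1 : (1 : WithTop ℕ∞) ≤ (s : WithTop ℕ∞) := by exact_mod_cast hs
  have hadd : ∀ e : OpenPartialHomeomorph M (E n), chartExpr e (fun p => v p + W p) =
      fun y => chartExpr e v y + chartExpr e W y := fun e => funext fun y => chartExpr_add v W y
  refine ⟨fun p => v p + W p, fun i => ⟨?_, fun y hy => ?_⟩, fun x hx => ?_, fun p hp => ?_, ?_⟩
  · rw [hadd]
    exact (hv i).1.add (𝒜.chart i).open_target (hreg.isHolderClassOn hWs i)
  · have h1 : DifferentiableAt ℝ (chartExpr (𝒜.chart i) v) y :=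
      (((hv i).1.1.contDiffAt ((𝒜.chart i).open_target.mem_nhds hy)).of_le hs1).differentiableAt
        (by simp)
    have h2 : DifferentiableAt ℝ (chartExpr (𝒜.chart i) W) y :=
      ((hWs _ (𝒜.mem_maximalAtlas i) y hy).1.of_le hs1).differentiableAt (by simp)
    rw [divInChart_eq_euclDiv (hcons.1 i) _ hy, hadd, euclDiv_add h1 h2, hWd i y hy,
      ← divInChart_eq_euclDiv (hcons.1 i) v hy, (hv i).2 y hy, add_zero]
  · have hpt := (𝒜.chart (c x)).map_source (hc x hx)
    have h1 : ∀ᶠ p in 𝓝 ((𝒜.chart (c x)).symm (𝒜.chart (c x) x)), W p = Y x p := by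
      rw [(𝒜.chart (c x)).left_inv (hc x hx)]
      filter_upwards [(hN x).2.mem_nhds (hN x).1] with p hp
      refine Finset.sum_eq_single_of_mem x hx fun z hz hzx => hY0 z hz p fun hpz => ?_
      exact disjoint_left.1 (hNd hz hx hzx) (hCN z hz hpz).1 hp
    filter_upwards [chartExpr_congr hpt h1, hYv x hx] with y h2 h3
    rw [hadd]
    dsimp only
    rw [h2, h3]
    abel
  · have : W p = 0 := Finset.sum_eq_zero fun x hx => hY0 x hx p fun h => hp (hCN x hx h).2
    dsimp only
    rw [this, add_zero]
  · have h1 : (fun p => v p + W p - v p) = W := funext fun p => add_sub_cancel_left (v p) (W p)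
    rw [h1]
    exact (FiniteAtlas.whitneyNorm_one_le hWb).trans_lt
      ((ENNReal.ofReal_lt_ofReal_iff hε).2 (half_lt_self hε))
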